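/- Let $k$ be a field, let $\ell \ge 3$, and let $a_1,\dots,a_\ell$ be positive integers with $\gcd(a_1,\dots,a_\ell)=1$ such that $a_j \notin \langle a_i \mid i \ne j\rangle$ for every $1\le j\le \ell$. Let $H=\langle a_1,\dots,a_\ell\rangle\subseteq\mathbb Z_{\ge 0}$ be the numerical semigroup they generate, and let $R=k[[H]]=k[[t^{a_1},\dots,t^{a_\ell}]]\subseteq k[[t]]$ be its semigroup ring, with maximal ideal $\mathfrak m$. Let $f=\max(\mathbb Z\setminus H)$ be the Frobenius number, let $\mathrm{PF}(H)=\{n\in\mathbb Z\setminus H \mid n+a_i\in H \text{ for all } i\}$, and let $K=\sum_{c\in \mathrm{PF}(H)}R\,t^{f-c}\subseteq k[[t]]$. Assume that the Cohen–Macaulay type $r(R)=\ell_R(\mathrm{Ext}^1_R(R/\mathfrak m,R))$ equals $2$ and that $K=R+Rt^a$ for an integer $a>0$. Then the following conditions are equivalent. 1. $R$ is a 2-almost Gorenstein local (2-AGL) ring. 2. $3a\in H$ and $f=2a+a_i$ for some $1\le i\le \ell$. Here a one-dimensional Cohen–Macaulay local ring $(R,\mathfrak m)$ is called 2-AGL if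 it has a canonical ideal $I$ (an ideal $I\ne R$ isomorphic to the canonical module of $R$) containing a parameter ideal $Q=(\alpha)$ as a reduction (that is, $I^{n+1}=QI^n$ for some $n\ge 0$) such that the Sally module $\mathcal S_Q(I)=I\,R[IX]/I\,R[QX]$, a module over the Rees algebra $\mathcal T=R[QX]\subseteq R[X]$, has rank $2$, that is, $\ell_{\mathcal T_{\mathfrak p}}(\mathcal S_Q(I)_{\mathfrak p})=2$ for the prime ideal $\mathfrak p=\mathfrak m\mathcal T$ (this rank does not depend on the choice of $I$ and $Q$). -/

import Mathlib

open scoped Polynomial PowerSeries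

universe u

noncomputable section

namespace TwoAGL

section LocalRing

variable (R : Type u) [CommRing R]

open CategoryTheory CategoryTheory.Abelian

/-- `Ext^i_R(R/𝔪, M)` for a local ring `(R, 𝔪)`. -/
abbrev ResidueExt [IsLocalRing R] (M : Type u) [AddCommGroup M] [Module R M] (i : ℕ) : Type u :=
  Ext (ModuleCat.of R (IsLocalRing.ResidueField R)) (ModuleCat.of R M) i

/-- The Cohen-Macaulay type `r(R) = ℓ_R(Ext^1_R(R/𝔪, R))` of a one-dimensional Cohen-Macaulay
local ring. -/
def cmType [IsLocalRing R] : ℕ∞ :=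
  Module.length R (ResidueExt R R 1)

/-- Canonical modules of a one-dimensional Cohen-Macaulay local ring `R`: finitely generated
maximal Cohen-Macaulay modules (of depth one: `Ext^0(R/𝔪, M) = 0` and `Ext^1(R/𝔪, M) ≠ 0`)
of type one (`ℓ_R(Ext^1(R/𝔪, M)) = 1`) and of finite injective dimension. -/
structure IsCanonicalModule [IsLocalRing R] (M : Type u) [AddCommGroup M] [Module R M] :
    Prop where
  finite : Module.Finite R M
  ext_zero : Subsingleton (ResidueExt R M 0)
  type_one : Module.length R (ResidueExt R M 1) = 1
  finite_injective_dimension : ∃ n : ℕ, HasInjectiveDimensionLT (ModuleCat.of R M) n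

/-- A canonical ideal of `R`: a proper ideal that is, as a module, a canonical module of `R`. -/
def IsCanonicalIdeal [IsLocalRing R] (I : Ideal R) : Prop :=
  I ≠ ⊤ ∧ IsCanonicalModule R I

variable {R}

/-- `Q ⊆ I` is a reduction of `I`: `I^{n+1} = Q I^n` for some `n`. -/
def IsReductionOf (Q I : Ideal R) : Prop :=
  Q ≤ I ∧ ∃ n : ℕ, I ^ (n + 1) = Q * I ^ n

/-- `I · R[I X]` as a submodule of `R[X]` over the Rees algebra `𝒯 = R[Q X]`, `Q = (a)`,
where `a ∈ I`. It is generated by all products of an element of `I` and an element of `R[I X]`. -/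
def sallyNumerator (I : Ideal R) (a : R) :
    Submodule (reesAlgebra (Ideal.span {a})) R[X] :=
  Submodule.span _ {p | ∃ c ∈ I, ∃ q ∈ reesAlgebra I, p = Polynomial.C c * q}

/-- `I · R[Q X]` as a submodule of `R[X]` over the Rees algebra `𝒯 = R[Q X]`, `Q = (a)`. -/
def sallyDenominator (I : Ideal R) (a : R) :
    Submodule (reesAlgebra (Ideal.span {a})) R[X] :=
  Submodule.span _ {p | ∃ c ∈ I, p = Polynomial.C c}

/-- For submodules `N`, `D` of `M` with `D ⊆ N`, the quotient module `N / D`. -/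
abbrev Subquotient {B M : Type u} [CommRing B] [AddCommGroup M] [Module B M]
    (N D : Submodule B M) : Type u :=
  N ⧸ D.submoduleOf N

/-- The Sally module `𝒮_Q(I) = I · R[I X] / I · R[Q X]`, a module over `𝒯 = R[Q X]`, `Q = (a)`. -/
abbrev SallyModule (I : Ideal R) (a : R) : Type u :=
  Subquotient (sallyNumerator I a) (sallyDenominator I a)

/-- The ideal `𝔪𝒯` of the Rees algebra `𝒯 = R[Q X]`, `Q = (a)`. -/
def fiberIdeal [IsLocalRing R] (a : R) : Ideal (reesAlgebra (Ideal.span {a})) :=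
  (IsLocalRing.maximalIdeal R).map (algebraMap R (reesAlgebra (Ideal.span {a})))

/-- For a nonzerodivisor `a`, the Rees algebra of `(a)` is a polynomial ring over `R`
in the variable `a X`, so that `𝔪𝒯` is a prime ideal. -/
theorem fiberIdeal_isPrime [IsLocalRing R] (a : R) (ha : a ∈ nonZeroDivisors R) :
    (fiberIdeal a).IsPrime := by
  have hmem : Polynomial.C a * Polynomial.X ∈ reesAlgebra (Ideal.span {a}) := by
    intro i
    rw [Polynomial.coeff_C_mul, Polynomial.coeff_X]
    split_ifs with h
    · subst h
      simp
    · simp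
  let φ : R[X] →ₐ[R] reesAlgebra (Ideal.span {a}) :=
    Polynomial.aeval ⟨Polynomial.C a * Polynomial.X, hmem⟩
  have hcoeff : ∀ (p : R[X]) (n : ℕ), ((φ p : R[X])).coeff n = a ^ n * p.coeff n := by
    intro p n
    have h1 : (φ p : R[X]) = Polynomial.aeval (Polynomial.C a * Polynomial.X) p := by
      simp [φ]
    rw [h1]
    induction p using Polynomial.induction_on' with
    | add p q hp hq =>
      have e : ∀ p : R[X], (φ p : R[X]) = Polynomial.aeval (Polynomial.C a * Polynomial.X) p := by
        intro p
        simp [φ]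
      rw [map_add, Polynomial.coeff_add, hp (e p), hq (e q), Polynomial.coeff_add, mul_add]
    | monomial m r =>
      rw [Polynomial.aeval_monomial, mul_pow, ← Polynomial.C_pow, Polynomial.algebraMap_eq,
        Polynomial.coeff_C_mul, Polynomial.coeff_C_mul, Polynomial.coeff_X_pow,
        Polynomial.coeff_monomial]
      by_cases h : n = m
      · subst h; simp [mul_comm]
      · simp [h, Ne.symm h]
  have hinj : Function.Injective φ := by
    rw [injective_iff_map_eq_zero]
    intro p hp
    ext n
    have h := hcoeff p n
    rw [hp] at h
    have h2 : a ^ n * p.coeff n = 0 := by simpa using h.symm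
    simpa using ((nonZeroDivisors R).pow_mem ha n).1 _ h2
  have hsurj : Function.Surjective φ := by
    intro q
    have h : ∀ n, ∃ c, a ^ n * c = (q : R[X]).coeff n := by
      intro n
      have := q.2 n
      rw [Ideal.span_singleton_pow, Ideal.mem_span_singleton] at this
      obtain ⟨c, hc⟩ := this
      exact ⟨c, hc.symm⟩
    choose c hc using h
    refine ⟨∑ n ∈ (q : R[X]).support, Polynomial.monomial n (c n), ?_⟩
    apply Subtype.ext
    ext n
    rw [hcoeff, Polynomial.finsetSum_coeff]
    simp only [Polynomial.coeff_monomial, Finset.sum_ite_eq']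
    split_ifs with hn
    · exact hc n
    · simpa using (Polynomial.notMem_support_iff.mp hn).symm
  let e : R[X] ≃+* reesAlgebra (Ideal.span {a}) :=
    (AlgEquiv.ofBijective φ ⟨hinj, hsurj⟩).toRingEquiv
  have hp : ((IsLocalRing.maximalIdeal R).map (Polynomial.C : R →+* R[X])).IsPrime :=
    Ideal.isPrime_map_C_of_isPrime
  have key : fiberIdeal a
      = ((IsLocalRing.maximalIdeal R).map (Polynomial.C : R →+* R[X])).map (e : R[X] →+* _) := by
    rw [Ideal.map_map, fiberIdeal]
    congr 1
    ext1 r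
    exact (φ.commutes r).symm
  rw [key]
  exact Ideal.map_isPrime_of_equiv e

/-- The rank `ℓ_{𝒯_𝔭}(𝒮_Q(I)_𝔭)`, `𝔭 = 𝔪𝒯`, of the Sally module of `I` with respect to
`Q = (a)`. -/
def sallyRank [IsLocalRing R] (I : Ideal R) (a : R) (ha : a ∈ nonZeroDivisors R) : ℕ∞ :=
  haveI := fiberIdeal_isPrime a ha
  Module.length (Localization.AtPrime (fiberIdeal a))
    (LocalizedModule (fiberIdeal a).primeCompl (SallyModule I a))

variable (R)

/-- A one-dimensional Cohen-Macaulay local ring `R` is 2-almost Gorenstein if it has a canonical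
ideal `I` and a parameter ideal `Q = (a)` that is a reduction of `I`, such that the Sally module
of `I` with respect to `Q` has rank two. (Parameters of a one-dimensional Cohen-Macaulay local
ring are the nonzerodivisors in the maximal ideal; the rank does not depend on `I` and `Q`.) -/
def IsTwoAGL [IsLocalRing R] : Prop :=
  ∃ (I : Ideal R) (a : R) (ha : a ∈ nonZeroDivisors R),
    IsCanonicalIdeal R I ∧ IsReductionOf (Ideal.span {a}) I ∧ sallyRank I a ha = 2

end LocalRing

section SemigroupRing

variable (k : Type u) [Field k]

/-- The semigroup ring `k[[H]]`: all power series in `k[[t]]` whose exponents lie in `H`. -/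
def semigroupRing (H : AddSubmonoid ℕ) : Subalgebra k k⟦X⟧ where
  carrier := {p | ∀ n, n ∉ H → PowerSeries.coeff n p = 0}
  mul_mem' := by
    intro p q hp hq n hn
    rw [PowerSeries.coeff_mul]
    refine Finset.sum_eq_zero fun x hx => ?_
    rw [Finset.HasAntidiagonal.mem_antidiagonal] at hx
    by_cases h1 : x.1 ∈ H
    · have h2 : x.2 ∉ H := fun h2 => hn (hx ▸ H.add_mem h1 h2)
      rw [hq _ h2, mul_zero]
    · rw [hp _ h1, zero_mul]
  add_mem' := by
    intro p q hp hq n hn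
    rw [map_add, hp n hn, hq n hn, add_zero]
  algebraMap_mem' := by
    intro r n hn
    have : n ≠ 0 := fun h => hn (h ▸ H.zero_mem)
    rw [PowerSeries.algebraMap_apply, PowerSeries.coeff_C, if_neg this]

instance semigroupRing_isLocalRing (H : AddSubmonoid ℕ) : IsLocalRing (semigroupRing k H) := by
  have : IsLocalHom (semigroupRing k H).val.toRingHom := by
    constructor
    intro p hp
    obtain ⟨q, hq⟩ := hp.exists_right_inv
    change (p : k⟦X⟧) * q = 1 at hq
    have h0 : PowerSeries.coeff 0 (p : k⟦X⟧) * PowerSeries.coeff 0 q = 1 := by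
      have := congrArg (PowerSeries.coeff 0) hq
      simpa using this
    have hp0 : PowerSeries.coeff 0 (p : k⟦X⟧) ≠ 0 := left_ne_zero_of_mul_eq_one h0
    have hqH : ∀ n, n ∉ H → PowerSeries.coeff n q = 0 := by
      intro n
      induction n using Nat.strong_induction_on with
      | _ n ih =>
        intro hn
        have hn0 : n ≠ 0 := fun h => hn (h ▸ H.zero_mem)
        have h := congrArg (PowerSeries.coeff n) hq
        rw [PowerSeries.coeff_mul, PowerSeries.coeff_one, if_neg hn0,
          Finset.sum_eq_single (0, n)] at h
        · exact (mul_eq_zero.mp h).resolve_left hp0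
        · intro x hx hne
          rw [Finset.HasAntidiagonal.mem_antidiagonal] at hx
          by_cases h1 : x.1 ∈ H
          · have h2 : x.2 ∉ H := fun h2 => hn (hx ▸ H.add_mem h1 h2)
            have h3 : x.1 ≠ 0 := by
              intro h3
              apply hne
              ext
              · exact h3
              · simpa [h3] using hx
            rw [ih x.2 (by omega) h2, mul_zero]
          · rw [p.2 _ h1, zero_mul]
        · intro h
          exact absurd (Finset.HasAntidiagonal.mem_antidiagonal.mpr (zero_add n)) h
    exact IsUnit.of_mul_eq_one ⟨q, hqH⟩ (Subtype.ext hq)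
  exact RingHom.domain_isLocalRing (semigroupRing k H).val.toRingHom

/-- The numerical semigroup `H = ⟨g_1, …, g_ℓ⟩`. -/
def semigroup {ℓ : ℕ} (g : Fin ℓ → ℕ) : AddSubmonoid ℕ :=
  AddSubmonoid.closure (Set.range g)

/-- The pseudo-Frobenius numbers of `H = ⟨g_1, …, g_ℓ⟩`: the integers `n ∉ H` such that
`n + g_i ∈ H` for all `i`. -/
def pseudoFrobenius {ℓ : ℕ} (g : Fin ℓ → ℕ) : Set ℤ :=
  {n | (¬ ∃ h ∈ semigroup g, (h : ℤ) = n) ∧ ∀ i, ∃ h ∈ semigroup g, (h : ℤ) = n + g i}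

/-- The fractional canonical ideal `K = ∑_{c ∈ PF(H)} R t^{f - c}` of `R = k[[H]]`,
an `R`-submodule of `k[[t]]`; here `f` is the Frobenius number of `H`. -/
def fractionalCanonicalIdeal {ℓ : ℕ} (g : Fin ℓ → ℕ) (f : ℕ) :
    Submodule (semigroupRing k (semigroup g)) k⟦X⟧ :=
  Submodule.span _
    {p | ∃ c ∈ pseudoFrobenius g, ∃ m : ℕ, (m : ℤ) = f - c ∧ p = (PowerSeries.X : k⟦X⟧) ^ m}

end SemigroupRing

end TwoAGL

end

/-! Everything happens inside k((t)), where submodules are compared through exponents. Let T be the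
set of n with f - n ∉ H. The canonical fractional ideal K consists of the series supported in T, and
the hypothesis on K says T = H ∪ (a + H) (`mem_dualExponents_iff`). Put H' = H + ℕa and S = k[[H']],
so that S = R[K] = K^m for large m.

An ideal I of type one has the form βK (`exists_forall_mem_canonicalFractional_iff`): Ext^1(R/𝔪, I)
is the socle of k((t))/I, and a functional detecting this socle is x ↦ coefficient of t^f in yx.
Conversely t^{f+1}K is a canonical ideal with reduction (t^{f+1}) (`exists_canonicalIdeal`); its
finite injective dimension comes from the injectivity of k((t))/K, a form of Matlis duality.

If (α) is a reduction of I = βK, then α = βu with u a unit of S. Hence I^{n+1} ⊆ α^n β S, with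
equality for large n, while α^n I = α^n β K. The n-th piece of the Sally module is thus I^{n+1}/α^n
I, eventually a copy of S/K, and its rank is the length of S/K, namely the number of elements of H'
outside T (`sallyRank_semigroupRing`, `sallyRank_canonicalIdeal`).

Reflecting by n ↦ f - n, the rank counts the h ∈ H with f - h ∈ H + ℕa. This set is closed under
taking summands in H, so if it has two elements it is {0, a_i}; the duality n ∈ T ↔ f - n ∉ H then
forces f = 2a + a_i and 3a ∈ H. The converse uses that a_i is an atom of H (`card_eq_two_iff`). -/

noncomputable section

namespace TwoAGL

/-! ### Ext^1 from the residue field as a socle, and a criterion for canonical modules. -/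

section ExtComputation

open CategoryTheory CategoryTheory.Abelian

variable {R : Type u} [CommRing R]

/-- If `0 → M → F → Q → 0` is exact with `F` injective and `Hom(X, F) = 0`, then the connecting
map `Hom(X, Q) → Ext^1(X, M)` is an isomorphism. -/
def homEquivExtOne {S : ShortComplex (ModuleCat.{u} R)} (hS : S.ShortExact)
    [Injective S.X₂] (X : ModuleCat.{u} R) (h0 : ∀ φ : X ⟶ S.X₂, φ = 0) :
    (X ⟶ S.X₃) ≃ₗ[R] Ext X S.X₁ 1 :=
  LinearEquiv.ofBijective
    (((Ext.bilinearCompOfLinear R X S.X₃ S.X₁ 0 1 1 (zero_add 1)).flip hS.extClass).comp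
      (Ext.linearEquiv₀ (R := R)).symm.toLinearMap) (by
    constructor
    · rw [injective_iff_map_eq_zero]
      intro φ hφ
      obtain ⟨x, hx⟩ := Ext.covariant_sequence_exact₃ X hS (Ext.mk₀ φ) (zero_add 1)
        (by simpa using hφ)
      have : x = 0 := by
        rw [← Ext.mk₀_linearEquiv₀_apply (R := R) x, h0 (Ext.linearEquiv₀ (R := R) x),
          Ext.mk₀_zero]
      rw [this, Ext.zero_comp] at hx
      exact (Ext.mk₀_eq_zero_iff φ).1 hx.symm
    · intro x
      obtain ⟨y, hy⟩ := Ext.covariant_sequence_exact₁ X hS x (Ext.eq_zero_of_injective _)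
        (zero_add 1)
      refine ⟨Ext.linearEquiv₀ (R := R) y, ?_⟩
      simpa using hy)

variable {F M : Type u} [AddCommGroup F] [Module R F] [AddCommGroup M] [Module R M]

theorem shortExact_of_injective (i : M →ₗ[R] F) (hi : Function.Injective i) :
    (ShortComplex.mk (ModuleCat.ofHom i) (ModuleCat.ofHom (LinearMap.range i).mkQ)
      (by ext x; simp)).ShortExact where
  exact := (ShortComplex.ShortExact.moduleCat_exact_iff_function_exact _).mpr
    fun _ => by simp
  mono_f := (ModuleCat.mono_iff_injective _).mpr hi
  epi_g := (ModuleCat.epi_iff_surjective _).mpr (Submodule.mkQ_surjective _)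

variable [IsLocalRing R]

open IsLocalRing

theorem hom_residueField_eq_zero (hF : ∀ x : F, (∀ r ∈ maximalIdeal R, r • x = 0) → x = 0)
    (φ : ResidueField R →ₗ[R] F) : φ = 0 := by
  have h1 : φ 1 = 0 := hF _ fun r hr => by
    rw [← map_smul, Algebra.smul_def, ResidueField.algebraMap_eq,
      (residue_eq_zero_iff r).2 hr, zero_mul, map_zero]
  ext x
  obtain ⟨r, rfl⟩ := residue_surjective x
  have : residue R r = r • (1 : ResidueField R) := by
    rw [Algebra.smul_def, ResidueField.algebraMap_eq, mul_one]
  rw [this, map_smul, h1, smul_zero, LinearMap.zero_apply]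

/-- A map out of the residue field is determined by the image of 1, which can be any element killed
by 𝔪. So the Hom module is the socle of F, and length one means that the socle is nonzero and
cyclic. -/
theorem length_hom_residueField_eq_one_iff :
    Module.length R (ResidueField R →ₗ[R] F) = 1 ↔
      ∃ z : F, z ≠ 0 ∧ (∀ r ∈ maximalIdeal R, r • z = 0) ∧
        ∀ w : F, (∀ r ∈ maximalIdeal R, r • w = 0) → ∃ r : R, w = r • z := by
  have hsm : ∀ r : R, residue R r = r • (1 : ResidueField R) := fun r => by
    rw [Algebra.smul_def, ResidueField.algebraMap_eq, mul_one]
  have hext : ∀ φ ψ : ResidueField R →ₗ[R] F, φ 1 = ψ 1 → φ = ψ := by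
    intro φ ψ h
    ext x
    obtain ⟨r, rfl⟩ := residue_surjective x
    rw [hsm, map_smul, map_smul, h]
  have hker : ∀ φ : ResidueField R →ₗ[R] F, ∀ r ∈ maximalIdeal R, r • φ 1 = 0 := by
    intro φ r hr
    rw [← map_smul, ← hsm, (residue_eq_zero_iff r).2 hr, map_zero]
  have hex : ∀ w : F, (∀ r ∈ maximalIdeal R, r • w = 0) →
      ∃ φ : ResidueField R →ₗ[R] F, φ 1 = w := by
    intro w hw
    refine ⟨Submodule.liftQ (maximalIdeal R) (LinearMap.toSpanSingleton R F w)
      (fun r hr => by simpa using hw r hr), ?_⟩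
    change Submodule.liftQ (maximalIdeal R) (LinearMap.toSpanSingleton R F w) _
      (Submodule.Quotient.mk 1) = w
    rw [← Submodule.mkQ_apply, ← LinearMap.comp_apply, Submodule.liftQ_mkQ,
      LinearMap.toSpanSingleton_apply, one_smul]
  rw [Module.length_eq_one_iff, isSimpleModule_iff_toSpanSingleton_surjective]
  constructor
  · rintro ⟨hn, hs⟩
    obtain ⟨φ, hφ⟩ := exists_ne (0 : ResidueField R →ₗ[R] F)
    refine ⟨φ 1, fun h => hφ (hext _ _ (by simpa using h)), hker φ, fun w hw => ?_⟩
    obtain ⟨ψ, rfl⟩ := hex w hw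
    obtain ⟨r, rfl⟩ := hs φ hφ ψ
    exact ⟨r, by simp⟩
  · rintro ⟨z, hz, hmz, hgen⟩
    obtain ⟨φ, rfl⟩ := hex z hmz
    refine ⟨⟨φ, 0, fun h => hz (by simp [h])⟩, fun ψ hψ χ => ?_⟩
    obtain ⟨r, hr⟩ := hgen (ψ 1) (hker ψ)
    obtain ⟨s, hs⟩ := hgen (χ 1) (hker χ)
    have hru : IsUnit r := by
      by_contra h
      have : r ∈ maximalIdeal R := h
      exact hψ (hext _ _ (by rw [hr, hmz r this, LinearMap.zero_apply]))
    obtain ⟨v, rfl⟩ := hru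
    refine ⟨s * ↑v⁻¹, hext _ _ ?_⟩
    rw [LinearMap.toSpanSingleton_apply, LinearMap.smul_apply, hr, hs, smul_smul, mul_assoc,
      Units.inv_mul, mul_one]

/-- For an embedding `i` of `M` into an injective module with no socle, `M` has type one if and
only if the cokernel of `i` has a one-dimensional socle. -/
theorem length_residueExt_one_eq_one_iff [Module.Injective R F]
    (hF : ∀ x : F, (∀ r ∈ maximalIdeal R, r • x = 0) → x = 0)
    (i : M →ₗ[R] F) (hi : Function.Injective i) :
    Module.length R (ResidueExt R M 1) = 1 ↔
      ∃ z : F, z ∉ LinearMap.range i ∧ (∀ r ∈ maximalIdeal R, r • z ∈ LinearMap.range i) ∧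
        ∀ w : F, (∀ r ∈ maximalIdeal R, r • w ∈ LinearMap.range i) →
          ∃ r : R, w - r • z ∈ LinearMap.range i := by
  have hinj : Injective (ModuleCat.of R F) := Module.injective_object_of_injective_module R F
  have e := homEquivExtOne (shortExact_of_injective i hi) (ModuleCat.of R (ResidueField R))
    (fun φ => by
      ext1
      exact hom_residueField_eq_zero hF φ.hom)
  have e2 : (ModuleCat.of R (ResidueField R) ⟶ ModuleCat.of R (F ⧸ LinearMap.range i)) ≃ₗ[R]
    (ResidueField R →ₗ[R] (F ⧸ LinearMap.range i)) := ModuleCat.homLinearEquiv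
  rw [← (e2.symm.trans e).length_eq, length_hom_residueField_eq_one_iff]
  constructor
  · rintro ⟨z, hz, hmz, hgen⟩
    obtain ⟨z, rfl⟩ := Submodule.Quotient.mk_surjective _ z
    refine ⟨z, fun h => hz ((Submodule.Quotient.mk_eq_zero _).2 h), fun r hr => ?_, fun w hw => ?_⟩
    · rw [← Submodule.Quotient.mk_eq_zero, Submodule.Quotient.mk_smul]
      exact hmz r hr
    · obtain ⟨r, hr⟩ := hgen (Submodule.Quotient.mk w) (fun r hr => by
        rw [← Submodule.Quotient.mk_smul, Submodule.Quotient.mk_eq_zero]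
        exact hw r hr)
      refine ⟨r, ?_⟩
      rw [← Submodule.Quotient.mk_eq_zero, Submodule.Quotient.mk_sub, Submodule.Quotient.mk_smul,
        hr, sub_self]
  · rintro ⟨z, hz, hmz, hgen⟩
    refine ⟨Submodule.Quotient.mk z, fun h => hz ((Submodule.Quotient.mk_eq_zero _).1 h),
      fun r hr => ?_, fun w hw => ?_⟩
    · rw [← Submodule.Quotient.mk_smul, Submodule.Quotient.mk_eq_zero]
      exact hmz r hr
    · obtain ⟨w, rfl⟩ := Submodule.Quotient.mk_surjective _ w
      obtain ⟨r, hr⟩ := hgen w (fun r hr => by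
        rw [← Submodule.Quotient.mk_eq_zero, Submodule.Quotient.mk_smul]
        exact hw r hr)
      refine ⟨r, ?_⟩
      rw [← sub_eq_zero, ← Submodule.Quotient.mk_smul, ← Submodule.Quotient.mk_sub,
        Submodule.Quotient.mk_eq_zero]
      exact hr

/-- Sufficient conditions for a finite module `M` embedded in an injective module `F` to be
canonical. -/
theorem isCanonicalModule_of_injective [Module.Finite R M] [Module.Injective R F]
    (hF : ∀ x : F, (∀ r ∈ maximalIdeal R, r • x = 0) → x = 0)
    (i : M →ₗ[R] F) (hi : Function.Injective i)
    (hQ : Module.Injective R (F ⧸ LinearMap.range i))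
    (hsoc : ∃ z : F, z ∉ LinearMap.range i ∧
      (∀ r ∈ maximalIdeal R, r • z ∈ LinearMap.range i) ∧
      ∀ w : F, (∀ r ∈ maximalIdeal R, r • w ∈ LinearMap.range i) →
        ∃ r : R, w - r • z ∈ LinearMap.range i) :
    IsCanonicalModule R M := by
  -- The bound 2 is strict: 0 → M → F → F/M → 0 is an injective resolution of length one.
  refine ⟨inferInstance, ?_, (length_residueExt_one_eq_one_iff hF i hi).2 hsoc, 2, ?_⟩
  · have : Subsingleton (ModuleCat.of R (ResidueField R) ⟶ ModuleCat.of R M) := by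
      refine subsingleton_of_forall_eq 0 fun φ => ?_
      ext1
      exact hom_residueField_eq_zero (fun x hx => hi (by
        rw [map_zero]
        exact hF _ fun r hr => by rw [← map_smul, hx r hr, map_zero])) φ.hom
    exact (Ext.linearEquiv₀ (R := R)).toEquiv.subsingleton
  · have h1 : Injective (ModuleCat.of R F) := Module.injective_object_of_injective_module R F
    have h2 : Injective (ModuleCat.of R (F ⧸ LinearMap.range i)) :=
      Module.injective_object_of_injective_module R _
    exact (shortExact_of_injective i hi).hasInjectiveDimensionLT_X₁ 1
      (inferInstanceAs (HasInjectiveDimensionLT (ModuleCat.of R (F ⧸ LinearMap.range i)) 1))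
      (inferInstanceAs (HasInjectiveDimensionLT (ModuleCat.of R F) 2))

end ExtComputation

/-! ### Lengths of localized modules and filtered subquotients. -/

section Localization

variable {B : Type*} [CommRing B] (p : Ideal B) [p.IsPrime]
  {M : Type*} [AddCommGroup M] [Module B M]

/-- If, up to multiplication by elements outside `p`, the module `M` is generated by an element
with annihilator `p`, then `M_p` has length one. -/
theorem length_localizedModule_eq_one (x : M) (hpx : ∀ s ∈ p, s • x = 0)
    (hx : ∀ s ∉ p, s • x ≠ 0) (hgen : ∀ y : M, ∃ s ∉ p, ∃ b : B, s • y = b • x) :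
    Module.length (Localization.AtPrime p) (LocalizedModule p.primeCompl M) = 1 := by
  rw [Module.length_eq_one_iff, isSimpleModule_iff_toSpanSingleton_surjective]
  refine ⟨⟨LocalizedModule.mk x 1, 0, fun h => ?_⟩, fun y hy z => ?_⟩
  · rw [← LocalizedModule.zero_mk 1, LocalizedModule.mk_eq] at h
    obtain ⟨s, hs⟩ := h
    exact hx s s.2 (by simpa [Submonoid.smul_def] using hs)
  · induction y using LocalizedModule.induction_on with | _ y t
    induction z using LocalizedModule.induction_on with | _ z t'
    obtain ⟨s, hs, b, hb⟩ := hgen y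
    obtain ⟨s', hs', b', hb'⟩ := hgen z
    have hbp : b ∉ p := by
      intro hbp
      apply hy
      rw [hpx b hbp] at hb
      rw [← LocalizedModule.zero_mk 1, LocalizedModule.mk_eq]
      exact ⟨⟨s, hs⟩, by simpa [Submonoid.smul_def] using hb⟩
    -- From s y = b x and s' z = b' x, the scalar carrying y/t to z/t' is t b' s / (t' s' b).
    refine ⟨Localization.mk (t * b' * s) (t' * ⟨s', hs'⟩ * ⟨b, hbp⟩ : p.primeCompl), ?_⟩
    rw [LinearMap.toSpanSingleton_apply, LocalizedModule.mk_smul_mk, LocalizedModule.mk_eq]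
    refine ⟨1, ?_⟩
    simp only [one_smul, Submonoid.smul_def, Submonoid.coe_mul, smul_smul]
    have e1 : (t' * ((t : B) * b' * s)) • y = (t' * t * b' * b) • x := by
      rw [show (t' * ((t : B) * b' * s)) = (t' * t * b') * s by ring, mul_smul, hb, smul_smul]
    have e2 : ((t' : B) * s' * b * t) • z = (t' * t * b' * b) • x := by
      rw [show ((t' : B) * s' * b * t) = (t' * b * t) * s' by ring, mul_smul, hb', smul_smul]
      ring_nf
    rw [e1, e2]

/-- Localization is exact, so lengths add along 0 → W → W' → W'/W → 0; the conditions on x are those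
of `length_localizedModule_eq_one` for its class in W'/W. -/
theorem length_localizedModule_add_one (W W' : Submodule B M) (hWW' : W ≤ W') (x : M)
    (hxW' : x ∈ W') (hpx : ∀ s ∈ p, s • x ∈ W) (hx : ∀ s ∉ p, s • x ∉ W)
    (hgen : ∀ y ∈ W', ∃ s ∉ p, ∃ b : B, s • y - b • x ∈ W) :
    Module.length (Localization.AtPrime p) (LocalizedModule p.primeCompl W') =
      Module.length (Localization.AtPrime p) (LocalizedModule p.primeCompl W) + 1 := by
  let i : W →ₗ[B] W' := Submodule.inclusion hWW'
  let q : W' →ₗ[B] (W' ⧸ W.submoduleOf W') := (W.submoduleOf W').mkQ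
  have hex : Function.Exact i q := by
    rw [LinearMap.exact_iff, Submodule.ker_mkQ, Submodule.range_inclusion]
    rfl
  rw [Module.length_eq_add_of_exact (LocalizedModule.map p.primeCompl i)
    (LocalizedModule.map p.primeCompl q)
    (LocalizedModule.map_injective _ i (Submodule.inclusion_injective hWW'))
    (LocalizedModule.map_surjective _ q (Submodule.mkQ_surjective _))
    (LocalizedModule.map_exact _ i q hex)]
  congr 1
  have hz : ∀ y : W', q y = 0 ↔ (y : M) ∈ W := fun y => by
    rw [Submodule.mkQ_apply, Submodule.Quotient.mk_eq_zero]
    rfl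
  refine length_localizedModule_eq_one p (q ⟨x, hxW'⟩) (fun s hs => ?_) (fun s hs => ?_)
    (fun y => ?_)
  · rw [← map_smul, hz]
    exact hpx s hs
  · rw [← map_smul, Ne, hz]
    exact hx s hs
  · obtain ⟨y, rfl⟩ := Submodule.mkQ_surjective _ y
    obtain ⟨s, hs, b, hb⟩ := hgen y y.2
    refine ⟨s, hs, b, ?_⟩
    change s • q y = b • q ⟨x, hxW'⟩
    rw [← sub_eq_zero, ← map_smul, ← map_smul, ← map_sub, hz]
    exact hb

variable {B M : Type u} [CommRing B] (p : Ideal B) [p.IsPrime] [AddCommGroup M] [Module B M]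

/-- The image of `P` in the subquotient `N / D`. -/
def subquotientPart (N D P : Submodule B M) : Submodule B (Subquotient N D) :=
  (P.submoduleOf N).map (D.submoduleOf N).mkQ

theorem mkQ_mem_subquotientPart_iff {N D P : Submodule B M} (hDP : D ≤ P) (y : N) :
    (D.submoduleOf N).mkQ y ∈ subquotientPart N D P ↔ (y : M) ∈ P := by
  constructor
  · rintro ⟨z, hz, hzy⟩
    have h1 : z - y ∈ D.submoduleOf N := (Submodule.Quotient.eq _).1 hzy
    have h2 : ((z - y : N) : M) ∈ P := hDP h1
    rw [AddSubgroupClass.coe_sub] at h2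
    exact (Submodule.sub_mem_iff_right _ hz).1 h2
  · intro hy
    exact ⟨y, hy, rfl⟩

/-- The length of a localized subquotient `(N / D)_p`, computed from a decreasing filtration. -/
theorem length_localizedModule_subquotient (N D : Submodule B M) (P : ℕ → Submodule B M)
    (hD : ∀ c, D ≤ P c) (hP : ∀ c, P (c + 1) ≤ P c) (h0 : N ≤ P 0) (C : ℕ)
    (hC : ∀ x ∈ N, x ∈ P C → x ∈ D) (Δ : Finset ℕ) (hΔC : ∀ c ∈ Δ, c < C)
    (hΔ : ∀ c ∉ Δ, P c = P (c + 1))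
    (hstep : ∀ c ∈ Δ, ∃ x ∈ N, x ∈ P c ∧ (∀ s : B, s • x ∈ P (c + 1) ↔ s ∈ p) ∧
      ∀ y ∈ N, y ∈ P c → ∃ s ∉ p, ∃ b : B, s • y - b • x ∈ P (c + 1)) :
    Module.length (Localization.AtPrime p) (LocalizedModule p.primeCompl (Subquotient N D)) =
      Δ.card := by
  let len : ℕ → ℕ∞ := fun c => Module.length (Localization.AtPrime p)
    (LocalizedModule p.primeCompl (subquotientPart N D (P c)))
  -- Descending induction from C, where the filtration has become zero in N/D: each index in Δ adds
  -- one to the length, every other index adds nothing.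
  have hlen : ∀ c ≤ C, len c = (Δ.filter (c ≤ ·)).card := by
    intro c hc
    induction hc using Nat.decreasingInduction with
    | self =>
      have h1 : Δ.filter (C ≤ ·) = ∅ :=
        Finset.filter_eq_empty_iff.2 fun c hc => not_le.2 (hΔC c hc)
      have h2 : subquotientPart N D (P C) = ⊥ := by
        refine (Submodule.eq_bot_iff _).2 fun y hy => ?_
        obtain ⟨y, rfl⟩ := Submodule.mkQ_surjective _ y
        rw [mkQ_mem_subquotientPart_iff (hD C)] at hy
        rw [Submodule.mkQ_apply, Submodule.Quotient.mk_eq_zero]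
        exact hC y y.2 hy
      have h3 : Subsingleton (LocalizedModule p.primeCompl (subquotientPart N D (P C))) := by
        rw [h2]
        refine subsingleton_of_forall_eq 0 fun z => ?_
        induction z using LocalizedModule.induction_on with | _ z t
        rw [Subsingleton.elim z 0, LocalizedModule.zero_mk]
      rw [h1, Finset.card_empty, Nat.cast_zero]
      exact Module.length_eq_zero
    | of_succ c hc ih =>
      by_cases h : c ∈ Δ
      · obtain ⟨x, hxN, hxP, hx, hgen⟩ := hstep c h
        have h5 : Δ.filter (c ≤ ·) = insert c (Δ.filter (c + 1 ≤ ·)) := by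
          ext d
          simp only [Finset.mem_filter, Finset.mem_insert]
          constructor
          · rintro ⟨hd, hcd⟩
            rcases hcd.eq_or_lt with rfl | hlt
            · exact Or.inl rfl
            · exact Or.inr ⟨hd, hlt⟩
          · rintro (rfl | ⟨hd, hcd⟩)
            · exact ⟨h, le_rfl⟩
            · exact ⟨hd, (Nat.le_succ c).trans hcd⟩
        rw [h5, Finset.card_insert_of_notMem (by simp), Nat.cast_add, ← ih, Nat.cast_one]
        refine length_localizedModule_add_one p _ _
          (Submodule.map_mono fun _ hy => hP c hy) ((D.submoduleOf N).mkQ ⟨x, hxN⟩)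
          ((mkQ_mem_subquotientPart_iff (hD c) _).2 hxP) (fun s hs => ?_) (fun s hs => ?_)
          (fun y hy => ?_)
        · rw [← map_smul, mkQ_mem_subquotientPart_iff (hD (c + 1))]
          exact (hx s).2 hs
        · rw [← map_smul, mkQ_mem_subquotientPart_iff (hD (c + 1))]
          exact fun hc => hs ((hx s).1 hc)
        · obtain ⟨y, rfl⟩ := Submodule.mkQ_surjective _ y
          rw [mkQ_mem_subquotientPart_iff (hD c)] at hy
          obtain ⟨s, hs, b, hb⟩ := hgen y y.2 hy
          refine ⟨s, hs, b, ?_⟩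
          rw [← map_smul, ← map_smul, ← map_sub, mkQ_mem_subquotientPart_iff (hD (c + 1))]
          exact hb
      · have h5 : Δ.filter (c ≤ ·) = Δ.filter (c + 1 ≤ ·) := by
          refine Finset.filter_congr fun d hd => ⟨fun hcd => ?_, (Nat.le_succ c).trans⟩
          exact lt_of_le_of_ne hcd fun e => h (e ▸ hd)
        rw [h5, ← ih]
        exact congrArg (fun Q => Module.length (Localization.AtPrime p)
          (LocalizedModule p.primeCompl (subquotientPart N D Q))) (hΔ c h)
  have hsurj : Function.Surjective (subquotientPart N D (P 0)).subtype := fun y => by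
    obtain ⟨y, rfl⟩ := Submodule.mkQ_surjective _ y
    exact ⟨⟨_, (mkQ_mem_subquotientPart_iff (hD 0) y).2 (h0 y.2)⟩, rfl⟩
  have h1 := hlen 0 (Nat.zero_le C)
  simp only [Nat.zero_le, Finset.filter_true, len] at h1
  rw [← h1]
  exact (LinearEquiv.ofBijective (LocalizedModule.map p.primeCompl
    (subquotientPart N D (P 0)).subtype)
    ⟨LocalizedModule.map_injective _ _ (Submodule.subtype_injective _),
      LocalizedModule.map_surjective _ _ hsurj⟩).length_eq.symm

end Localization

/-! ### Degreewise description of the Sally module over the Rees algebra. -/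

section Rees

variable {R : Type u} [CommRing R]

/-- The element `r (α X)^n` of the Rees algebra of `(α)`. -/
def reesMonomial (α : R) (n : ℕ) (r : R) : reesAlgebra (Ideal.span {α}) :=
  ⟨Polynomial.monomial n (α ^ n * r), reesAlgebra.monomial_mem.2 (by
    rw [Ideal.span_singleton_pow]
    exact Ideal.mem_span_singleton.2 (dvd_mul_right _ _))⟩

theorem exists_coeff_reesAlgebra_eq {α : R} (s : reesAlgebra (Ideal.span {α})) (n : ℕ) :
    ∃ r, (s : R[X]).coeff n = α ^ n * r := by
  have := s.2 n
  rw [Ideal.span_singleton_pow, Ideal.mem_span_singleton] at this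
  exact this

/-- In degree n the Rees algebra is (α^n), so its extension of 𝔪 is α^n 𝔪 there. One direction
checks that these conditions define an ideal containing 𝔪; the other writes s as a finite sum of
terms r_n (αX)^n with r_n ∈ 𝔪. -/
theorem mem_fiberIdeal_iff [IsLocalRing R] {α : R} {s : reesAlgebra (Ideal.span {α})} :
    s ∈ fiberIdeal α ↔
      ∀ n, ∃ r ∈ IsLocalRing.maximalIdeal R, (s : R[X]).coeff n = α ^ n * r := by
  constructor
  · intro hs n
    let J : Ideal (reesAlgebra (Ideal.span {α})) :=
      { carrier := {s | ∀ n, (s : R[X]).coeff n ∈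
          Ideal.span {α ^ n} * IsLocalRing.maximalIdeal R}
        add_mem' := fun {s t} hs ht n => by
          rw [Subalgebra.coe_add, Polynomial.coeff_add]
          exact Ideal.add_mem _ (hs n) (ht n)
        zero_mem' := fun n => by
          rw [Subalgebra.coe_zero, Polynomial.coeff_zero]
          exact Ideal.zero_mem _
        smul_mem' := fun s t ht n => by
          rw [smul_eq_mul, Subalgebra.coe_mul, Polynomial.coeff_mul]
          refine Ideal.sum_mem _ fun ij hij => ?_
          have h := Ideal.mul_mem_mul (s.2 ij.1) (ht ij.2)
          rw [Ideal.span_singleton_pow, ← mul_assoc, Ideal.span_singleton_mul_span_singleton,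
            ← pow_add, Finset.HasAntidiagonal.mem_antidiagonal.1 hij] at h
          exact h }
    have hle : fiberIdeal α ≤ J := Ideal.map_le_iff_le_comap.2 fun r hr n => by
      change (Polynomial.C r).coeff n ∈ _
      rw [Polynomial.coeff_C]
      split_ifs with h
      · subst h
        rw [pow_zero, Ideal.span_singleton_one, Ideal.top_mul]
        exact hr
      · exact Ideal.zero_mem _
    obtain ⟨r, hr, h⟩ := Ideal.mem_span_singleton_mul.1 (hle hs n)
    exact ⟨r, hr, h.symm⟩
  · intro h
    choose r hr hs using h
    have : s = ∑ n ∈ (s : R[X]).support, algebraMap R _ (r n) * reesMonomial α n 1 := by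
      apply Subtype.ext
      conv_lhs => rw [(s : R[X]).as_sum_support]
      rw [AddSubmonoidClass.coe_finsetSum]
      refine Finset.sum_congr rfl fun n _ => ?_
      rw [hs n]
      change _ = Polynomial.C (r n) * Polynomial.monomial n (α ^ n * 1)
      rw [Polynomial.C_mul_monomial, mul_one, mul_comm]
    rw [this]
    exact Ideal.sum_mem _ fun n _ => Ideal.mul_mem_right _ _ (Ideal.mem_map_of_mem _ (hr n))

/-- Together with `monomial_mem_sallyNumerator`, this identifies the numerator with the sum of the
I^{n+1} X^n. Scalars of degree i have coefficients in (α)^i ⊆ I^i, which is where α ∈ I enters. -/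
theorem coeff_mem_of_mem_sallyNumerator {I : Ideal R} {α : R} (hα : α ∈ I) {p : R[X]}
    (hp : p ∈ sallyNumerator I α) (n : ℕ) : p.coeff n ∈ I ^ (n + 1) := by
  induction hp using Submodule.span_induction generalizing n with
  | mem p hp =>
    obtain ⟨c, hc, q, hq, rfl⟩ := hp
    rw [Polynomial.coeff_C_mul, pow_succ']
    exact Ideal.mul_mem_mul hc (hq n)
  | zero => rw [Polynomial.coeff_zero]; exact Ideal.zero_mem _
  | add p q _ _ hp hq => rw [Polynomial.coeff_add]; exact Ideal.add_mem _ (hp n) (hq n)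
  | smul s p _ hp =>
    change ((s : R[X]) * p).coeff n ∈ _
    rw [Polynomial.coeff_mul]
    refine Ideal.sum_mem _ fun ij hij => ?_
    rw [← Finset.HasAntidiagonal.mem_antidiagonal.1 hij, add_assoc, pow_add]
    exact Ideal.mul_mem_mul
      (Ideal.pow_right_mono ((Ideal.span_singleton_le_iff_mem I).2 hα) _ (s.2 ij.1)) (hp ij.2)

theorem monomial_mem_sallyNumerator {I : Ideal R} (α : R) {n : ℕ} {r : R}
    (hr : r ∈ I ^ (n + 1)) : Polynomial.monomial n r ∈ sallyNumerator I α := by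
  rw [pow_succ'] at hr
  induction hr using Submodule.mul_induction_on' with
  | mem_mul_mem c hc d hd =>
    refine Submodule.subset_span ⟨c, hc, Polynomial.monomial n d, reesAlgebra.monomial_mem.2 hd, ?_⟩
    rw [Polynomial.C_mul_monomial]
  | add x _ y _ hx hy =>
    rw [map_add]
    exact Submodule.add_mem _ hx hy

theorem mem_sallyDenominator_of_forall {I : Ideal R} {α : R} {p : R[X]}
    (h : ∀ n, ∃ c ∈ I, p.coeff n = α ^ n * c) : p ∈ sallyDenominator I α := by
  choose c hc hp using h
  rw [p.as_sum_support]
  refine Submodule.sum_mem _ fun n _ => ?_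
  have : Polynomial.monomial n (p.coeff n) = reesMonomial α n 1 • Polynomial.C (c n) := by
    change _ = Polynomial.monomial n (α ^ n * 1) * Polynomial.C (c n)
    rw [Polynomial.monomial_mul_C, mul_one, hp n]
  rw [this]
  exact Submodule.smul_mem _ _ (Submodule.subset_span ⟨c n, hc n, rfl⟩)

/-- The polynomials whose `n`-th coefficient lies in `G n`. -/
def coeffSubmodule (α : R) (G : ℕ → Ideal R) (hG : ∀ n, ∀ r ∈ G n, α * r ∈ G (n + 1)) :
    Submodule (reesAlgebra (Ideal.span {α})) R[X] where
  carrier := {p | ∀ n, p.coeff n ∈ G n}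
  add_mem' hp hq n := by
    rw [Polynomial.coeff_add]
    exact Ideal.add_mem _ (hp n) (hq n)
  zero_mem' n := by
    rw [Polynomial.coeff_zero]
    exact Ideal.zero_mem _
  smul_mem' s p hp n := by
    have hpow : ∀ i j r, r ∈ G j → α ^ i * r ∈ G (i + j) := by
      intro i j r hr
      induction i with
      | zero => rwa [pow_zero, one_mul, zero_add]
      | succ i ih =>
        rw [pow_succ', mul_assoc, Nat.add_right_comm]
        exact hG _ _ ih
    change ((s : R[X]) * p).coeff n ∈ _
    rw [Polynomial.coeff_mul]
    refine Ideal.sum_mem _ fun ij hij => ?_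
    obtain ⟨r, hr⟩ := exists_coeff_reesAlgebra_eq s ij.1
    rw [hr, ← Finset.HasAntidiagonal.mem_antidiagonal.1 hij, mul_right_comm]
    exact Ideal.mul_mem_right _ _ (hpow _ _ _ (hp ij.2))

theorem sallyDenominator_le_coeffSubmodule {I : Ideal R} {α : R} {G : ℕ → Ideal R}
    (hG : ∀ n, ∀ r ∈ G n, α * r ∈ G (n + 1)) (hI : I ≤ G 0) :
    sallyDenominator I α ≤ coeffSubmodule α G hG := by
  refine Submodule.span_le.2 ?_
  rintro p ⟨c, hc, rfl⟩ n
  rw [Polynomial.coeff_C]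
  split_ifs with h
  · rw [h]
    exact hI hc
  · exact Ideal.zero_mem _

/-- Membership is tested one degree at a time: the n-th coefficient of s is α^n r, and `hmax`
decides whether α^n r r₀ lands in G. So the class of r₀ X^N has annihilator 𝔪𝒯. -/
theorem smul_monomial_mem_coeffSubmodule_iff [IsLocalRing R] {α : R} {G : ℕ → Ideal R}
    (hG : ∀ n, ∀ r ∈ G n, α * r ∈ G (n + 1)) {N : ℕ} {r₀ : R}
    (hmax : ∀ n r, α ^ n * r * r₀ ∈ G (n + N) ↔ r ∈ IsLocalRing.maximalIdeal R)
    (s : reesAlgebra (Ideal.span {α})) :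
    s • Polynomial.monomial N r₀ ∈ coeffSubmodule α G hG ↔ s ∈ fiberIdeal α := by
  have hsx : ∀ n, ((s : R[X]) * Polynomial.monomial N r₀).coeff (n + N) =
      (s : R[X]).coeff n * r₀ := fun n => Polynomial.coeff_mul_monomial _ _ _ _
  change (∀ n, ((s : R[X]) * Polynomial.monomial N r₀).coeff n ∈ G n) ↔ _
  rw [mem_fiberIdeal_iff]
  constructor
  · intro h n
    obtain ⟨r, hr⟩ := exists_coeff_reesAlgebra_eq s n
    refine ⟨r, ?_, hr⟩
    rw [← hmax n, ← hr, ← hsx]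
    exact h (n + N)
  · intro h n
    rcases lt_or_ge n N with hn | hn
    · rw [← Polynomial.C_mul_X_pow_eq_monomial, ← mul_assoc, Polynomial.coeff_mul_X_pow',
        if_neg (not_le.2 hn)]
      exact Ideal.zero_mem _
    · obtain ⟨n, rfl⟩ := Nat.exists_eq_add_of_le' hn
      obtain ⟨r, hr, hsr⟩ := h n
      rw [hsx, hsr]
      exact (hmax n r).2 hr

/-- Makes (αX)^N an admissible denominator in the localization at 𝔪𝒯: otherwise α^N = α^N r with r ∈
𝔪, and cancelling gives r = 1. -/
theorem reesMonomial_notMem_fiberIdeal [IsLocalRing R] {α : R} (hα : α ∈ nonZeroDivisors R)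
    (N : ℕ) : reesMonomial α N 1 ∉ fiberIdeal α := by
  intro h
  obtain ⟨r, hr, h⟩ := mem_fiberIdeal_iff.1 h N
  change (Polynomial.monomial N (α ^ N * 1)).coeff N = _ at h
  rw [Polynomial.coeff_monomial_same] at h
  have := (mul_cancel_left_mem_nonZeroDivisors (pow_mem hα N)).1 h
  rw [← this] at hr
  exact (Ideal.ne_top_iff_one _).1 (IsLocalRing.maximalIdeal.isMaximal _).ne_top hr

/-- Multiplying by (αX)^N moves y into the degrees reached by multiples of r₀ X^N. The coefficients
are then corrected separately, and as y has finite support the corrections form one Rees element. -/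
theorem exists_smul_sub_smul_monomial_mem {α : R} {G G' : ℕ → Ideal R}
    (hG' : ∀ n, ∀ r ∈ G' n, α * r ∈ G' (n + 1)) {N : ℕ} {r₀ : R}
    (hgen : ∀ n, ∀ y ∈ G n, ∃ γ, α ^ N * y - α ^ n * γ * r₀ ∈ G' (n + N))
    {y : R[X]} (hy : ∀ n, y.coeff n ∈ G n) :
    ∃ b : reesAlgebra (Ideal.span {α}), reesMonomial α N 1 • y - b • Polynomial.monomial N r₀ ∈
      coeffSubmodule α G' hG' := by
  choose γ hγ using fun n => hgen n _ (hy n)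
  let b : reesAlgebra (Ideal.span {α}) := ∑ n ∈ y.support, reesMonomial α n (γ n)
  have hb : ∀ n, (b : R[X]).coeff n = if n ∈ y.support then α ^ n * γ n else 0 := by
    intro n
    have h1 : (b : R[X]) = ∑ n ∈ y.support, Polynomial.monomial n (α ^ n * γ n) :=
      AddSubmonoidClass.coe_finsetSum _ _
    rw [h1, Polynomial.finsetSum_coeff]
    simp only [Polynomial.coeff_monomial, Finset.sum_ite_eq']
  refine ⟨b, fun n => ?_⟩
  change (Polynomial.monomial N (α ^ N * 1) * y -
    (b : R[X]) * Polynomial.monomial N r₀).coeff n ∈ G' n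
  rw [Polynomial.coeff_sub]
  rcases lt_or_ge n N with hn | hn
  · rw [← Polynomial.C_mul_X_pow_eq_monomial, ← Polynomial.C_mul_X_pow_eq_monomial, ← mul_assoc,
      Polynomial.coeff_mul_X_pow', if_neg (not_le.2 hn), mul_right_comm,
      Polynomial.coeff_mul_X_pow', if_neg (not_le.2 hn), sub_self]
    exact Ideal.zero_mem _
  · obtain ⟨n, rfl⟩ := Nat.exists_eq_add_of_le' hn
    rw [Polynomial.coeff_monomial_mul, Polynomial.coeff_mul_monomial, hb, mul_one]
    split_ifs with h
    · exact hγ n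
    · rw [Polynomial.notMem_support_iff.1 h, mul_zero, zero_mul, sub_self]
      exact Ideal.zero_mem _

/-- The rank of the Sally module, computed from a decreasing filtration. -/
theorem sallyRank_eq_card [IsLocalRing R] {I : Ideal R} {α : R} (hα : α ∈ nonZeroDivisors R)
    (hαI : α ∈ I) (G : ℕ → ℕ → Ideal R) (hG : ∀ c n, ∀ r ∈ G c n, α * r ∈ G c (n + 1))
    (hI : ∀ c, I ≤ G c 0) (hGG : ∀ c n, G (c + 1) n ≤ G c n) (h0 : ∀ n, I ^ (n + 1) ≤ G 0 n)
    (C : ℕ) (hC : ∀ n, ∀ r ∈ G C n, ∃ d ∈ I, r = α ^ n * d) (Δ : Finset ℕ) (hΔC : ∀ c ∈ Δ, c < C)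
    (hΔ : ∀ c ∉ Δ, ∀ n, G c n = G (c + 1) n)
    (hstep : ∀ c ∈ Δ, ∃ (N : ℕ) (r₀ : R), r₀ ∈ I ^ (N + 1) ∧ r₀ ∈ G c N ∧
      (∀ n r, α ^ n * r * r₀ ∈ G (c + 1) (n + N) ↔ r ∈ IsLocalRing.maximalIdeal R) ∧
      ∀ n, ∀ y ∈ G c n, ∃ γ, α ^ N * y - α ^ n * γ * r₀ ∈ G (c + 1) (n + N)) :
    sallyRank I α hα = Δ.card := by
  have hprime := fiberIdeal_isPrime α hα
  refine length_localizedModule_subquotient (fiberIdeal α) _ _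
    (fun c => coeffSubmodule α (G c) (hG c))
    (fun c => sallyDenominator_le_coeffSubmodule (hG c) (hI c)) (fun c p hp n => hGG c n (hp n))
    (fun p hp n => h0 n (coeff_mem_of_mem_sallyNumerator hαI hp n)) C
    (fun p _ hp => mem_sallyDenominator_of_forall fun n => hC n _ (hp n)) Δ hΔC
    (fun c hc => ?_) (fun c hc => ?_)
  · ext p
    exact forall_congr' fun n => by rw [hΔ c hc n]
  · obtain ⟨N, r₀, h1, h2, h3, h4⟩ := hstep c hc
    refine ⟨Polynomial.monomial N r₀, monomial_mem_sallyNumerator α h1, fun n => ?_,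
      smul_monomial_mem_coeffSubmodule_iff (hG (c + 1)) h3, fun y _ hy =>
      ⟨reesMonomial α N 1, reesMonomial_notMem_fiberIdeal hα N,
        exists_smul_sub_smul_monomial_mem (hG (c + 1)) h4 hy⟩⟩
    rw [Polynomial.coeff_monomial]
    split_ifs with h
    · exact h ▸ h2
    · exact Ideal.zero_mem _

end Rees

open scoped LaurentSeries

/-! ### Laurent series with prescribed exponents, and functionals on k((t)). -/

section Supports

variable (k : Type u) [Field k]

/-- The Laurent series all of whose exponents lie in `T`. -/
def supportedIn (T : Set ℤ) : Submodule k k⸨X⸩ where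
  carrier := {x | ∀ n ∉ T, x.coeff n = 0}
  add_mem' hx hy n hn := by rw [HahnSeries.coeff_add, hx n hn, hy n hn, add_zero]
  zero_mem' _ _ := rfl
  smul_mem' c x hx n hn := by rw [HahnSeries.coeff_smul, hx n hn, smul_zero]

variable {k}

theorem supportedIn_mono {S T : Set ℤ} (h : S ⊆ T) : supportedIn k S ≤ supportedIn k T :=
  fun _ hx n hn => hx n fun hS => hn (h hS)

theorem mul_mem_supportedIn {S T U : Set ℤ} (h : ∀ s ∈ S, ∀ t ∈ T, s + t ∈ U) {x y : k⸨X⸩}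
    (hx : x ∈ supportedIn k S) (hy : y ∈ supportedIn k T) : x * y ∈ supportedIn k U := by
  intro n hn
  by_contra hne
  obtain ⟨s, hs, t, ht, rfl⟩ := HahnSeries.support_mul_subset (HahnSeries.mem_support _ _ |>.2 hne)
  refine hn (h s ?_ t ?_)
  · by_contra h'
    exact hs (hx s h')
  · by_contra h'
    exact ht (hy t h')

theorem single_mem_supportedIn {T : Set ℤ} {n : ℤ} (hn : n ∈ T) (c : k) :
    HahnSeries.single n c ∈ supportedIn k T := by
  intro m hm
  exact HahnSeries.coeff_single_of_ne fun h => hm (h ▸ hn)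

theorem one_mem_supportedIn {T : Set ℤ} (h : (0 : ℤ) ∈ T) : (1 : k⸨X⸩) ∈ supportedIn k T :=
  single_mem_supportedIn h 1

theorem exists_mem_supportedIn_Ici (x : k⸨X⸩) : ∃ n, x ∈ supportedIn k (Set.Ici n) :=
  ⟨x.order, fun _ hn => HahnSeries.coeff_eq_zero_of_lt_order (not_le.1 hn)⟩

/-- Every `k`-linear functional on `k((t))` vanishing on series of high order is of the form
`x ↦ (coefficient of t^f in y x)`. -/
theorem exists_forall_eq_coeff_mul (f N : ℤ) (ψ : k⸨X⸩ →ₗ[k] k)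
    (hψ : ∀ x ∈ supportedIn k (Set.Ici N), ψ x = 0) :
    ∃ y : k⸨X⸩, ∀ x, ψ x = (y * x).coeff f := by
  -- The coefficient of t^f in y t^m is the coefficient of y at f - m, so y is forced; its support
  -- is bounded below because ψ kills high orders.
  let y : k⸨X⸩ := HahnSeries.ofSuppBddBelow (fun n => ψ (HahnSeries.single (f - n) 1))
    ⟨f - N, fun n hn => by
      by_contra hlt
      exact hn (hψ _ (single_mem_supportedIn (Set.mem_Ici.2 (by omega)) 1))⟩
  have hy : ∀ n, y.coeff n = ψ (HahnSeries.single (f - n) 1) := fun n => rfl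
  have hyN : y ∈ supportedIn k (Set.Ici (f - N + 1)) := fun n hn => by
    rw [hy]
    exact hψ _ (single_mem_supportedIn (Set.mem_Ici.2 (by rw [Set.mem_Ici] at hn; omega)) 1)
  have hsingle : ∀ m c, ψ (HahnSeries.single m c) = (y * HahnSeries.single m c).coeff f := by
    intro m c
    have h1 : HahnSeries.single m c = c • HahnSeries.single m (1 : k) := by
      ext n
      rw [HahnSeries.coeff_smul, HahnSeries.coeff_single, HahnSeries.coeff_single]
      split_ifs <;> simp
    rw [HahnSeries.coeff_mul_single, hy, sub_sub_cancel, h1, map_smul, smul_eq_mul, mul_comm]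
  refine ⟨y, fun x => ?_⟩
  obtain ⟨m, hm⟩ := exists_mem_supportedIn_Ici x
  -- The part of x below order N is a finite sum of monomials. The rest is killed by ψ, and it
  -- contributes nothing to the coefficient at f because y has order greater than f - N.
  let z : k⸨X⸩ := ∑ n ∈ Finset.Ico m N, HahnSeries.single n (x.coeff n)
  have hz : ψ z = (y * z).coeff f := by
    simp only [z, map_sum, Finset.mul_sum, HahnSeries.coeff_sum, hsingle]
  have hxz : x - z ∈ supportedIn k (Set.Ici N) := by
    intro n hn
    have hc : z.coeff n = ∑ i ∈ Finset.Ico m N, if n = i then x.coeff i else 0 := by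
      simp only [z, HahnSeries.coeff_sum]
      refine Finset.sum_congr rfl fun i _ => ?_
      rw [HahnSeries.coeff_single]
      congr
    rw [HahnSeries.coeff_sub, hc, Finset.sum_ite_eq]
    split_ifs with h
    · exact sub_self _
    · rw [sub_zero]
      exact hm n fun h' => h (Finset.mem_Ico.2 ⟨h', not_le.1 hn⟩)
  have h0 : (y * (x - z)).coeff f = 0 := by
    refine mul_mem_supportedIn (U := Set.Ici (f + 1)) (fun s hs t ht => ?_) hyN hxz f (by simp)
    rw [Set.mem_Ici] at *
    omega
  have h1 := hψ _ hxz
  rw [mul_sub, HahnSeries.coeff_sub, ← hz, sub_eq_zero] at h0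
  rw [map_sub, sub_eq_zero] at h1
  rw [h1, h0]

end Supports

/-- By Baer's criterion: since j φ(x) = x φ(j), a map φ on a nonzero ideal is multiplication by
φ(x)/x for any nonzero x in it. -/
theorem injective_of_field (R F : Type u) [CommRing R] [Field F] [Algebra R F]
    [FaithfulSMul R F] : Module.Injective R F := by
  refine Module.Baer.injective fun J φ => ?_
  by_cases hJ : J = ⊥
  · refine ⟨0, fun x hx => ?_⟩
    subst hJ
    have : (⟨x, hx⟩ : (⊥ : Ideal R)) = 0 := Subsingleton.elim _ _
    rw [this, map_zero, LinearMap.zero_apply]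
  · obtain ⟨x, hx, hx0⟩ := Submodule.exists_mem_ne_zero_of_ne_bot hJ
    have hx0' : algebraMap R F x ≠ 0 := by
      rwa [Ne, FaithfulSMul.algebraMap_eq_zero_iff]
    refine ⟨LinearMap.toSpanSingleton R F (φ ⟨x, hx⟩ / algebraMap R F x), fun j hj => ?_⟩
    have h : j • φ ⟨x, hx⟩ = x • φ ⟨j, hj⟩ := by
      rw [← map_smul, ← map_smul]
      congr 1
      exact Subtype.ext (mul_comm _ _)
    rw [Algebra.smul_def, Algebra.smul_def] at h
    rw [LinearMap.toSpanSingleton_apply, Algebra.smul_def, mul_div_assoc', h,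
      mul_div_cancel_left₀ _ hx0']

/-! ### The semigroup ring in k((t)), its canonical fractional ideal K, and injectivity of k((t))/K.
-/

section SemigroupRing

variable {k : Type u} [Field k] {H : AddSubmonoid ℕ}

instance : Module (semigroupRing k H) k⸨X⸩ := (semigroupRing k H).moduleLeft

instance (I : Ideal (semigroupRing k H)) : Module (semigroupRing k H) I := Submodule.module I

instance (K : Submodule (semigroupRing k H) k⸨X⸩) :
    Module (semigroupRing k H) (k⸨X⸩ ⧸ K) := Submodule.Quotient.module K

/-- The elements of `H`, as integers. -/
def exponents (H : AddSubmonoid ℕ) : Set ℤ := {n | ∃ h ∈ H, (h : ℤ) = n}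

theorem zero_mem_exponents : (0 : ℤ) ∈ exponents H := ⟨0, H.zero_mem, rfl⟩

theorem add_mem_exponents {m n : ℤ} (hm : m ∈ exponents H) (hn : n ∈ exponents H) :
    m + n ∈ exponents H := by
  obtain ⟨m, hm, rfl⟩ := hm
  obtain ⟨n, hn, rfl⟩ := hn
  exact ⟨m + n, H.add_mem hm hn, by push_cast; rfl⟩

theorem nonneg_of_mem_exponents {m : ℤ} (hm : m ∈ exponents H) : 0 ≤ m := by
  obtain ⟨m, -, rfl⟩ := hm
  exact Int.natCast_nonneg m

theorem natCast_mem_exponents {n : ℕ} : (n : ℤ) ∈ exponents H ↔ n ∈ H :=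
  ⟨fun ⟨_, hh, e⟩ => Nat.cast_injective e ▸ hh, fun h => ⟨n, h, rfl⟩⟩

theorem mem_exponents_of_lt {f : ℕ} (hlarge : ∀ n, f < n → n ∈ H) {n : ℤ} (h : (f : ℤ) < n) :
    n ∈ exponents H := by
  lift n to ℕ using by omega
  exact natCast_mem_exponents.2 (hlarge n (by exact_mod_cast h))

theorem algebraMap_semigroupRing_apply (r : semigroupRing k H) :
    algebraMap (semigroupRing k H) k⸨X⸩ r = HahnSeries.ofPowerSeries ℤ k (r : k⟦X⟧) := rfl

instance : IsScalarTower k (semigroupRing k H) k⸨X⸩ := ⟨fun c r x => by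
  change HahnSeries.ofPowerSeries ℤ k ((c • r : semigroupRing k H) : k⟦X⟧) * x =
    c • (HahnSeries.ofPowerSeries ℤ k (r : k⟦X⟧) * x)
  rw [← HahnSeries.single_zero_mul_eq_smul, ← mul_assoc, HahnSeries.single_zero_mul_eq_smul]
  congr 1
  ext n
  rw [HahnSeries.coeff_smul]
  by_cases hn : 0 ≤ n
  · lift n to ℕ using hn
    rw [LaurentSeries.coeff_coe_powerSeries, LaurentSeries.coeff_coe_powerSeries]
    rfl
  · rw [HahnSeries.ofPowerSeries_apply, HahnSeries.ofPowerSeries_apply,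
      HahnSeries.embDomain_of_notMem_range, HahnSeries.embDomain_of_notMem_range, smul_zero] <;>
    · rintro ⟨m, rfl⟩
      exact hn (by simp)⟩

theorem algebraMap_mem_supportedIn (r : semigroupRing k H) :
    algebraMap (semigroupRing k H) k⸨X⸩ r ∈ supportedIn k (exponents H) := by
  intro n hn
  rw [algebraMap_semigroupRing_apply]
  by_cases hn0 : 0 ≤ n
  · lift n to ℕ using hn0
    rw [LaurentSeries.coeff_coe_powerSeries]
    exact r.2 n fun h => hn (natCast_mem_exponents.2 h)
  · rw [HahnSeries.ofPowerSeries_apply, HahnSeries.embDomain_of_notMem_range]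
    rintro ⟨m, rfl⟩
    exact hn0 (by simp)

theorem exists_algebraMap_eq {x : k⸨X⸩} (hx : x ∈ supportedIn k (exponents H)) :
    ∃ r : semigroupRing k H, algebraMap (semigroupRing k H) k⸨X⸩ r = x := by
  refine ⟨⟨PowerSeries.mk fun n => x.coeff n, fun n hn => ?_⟩, ?_⟩
  · rw [PowerSeries.coeff_mk]
    exact hx n fun h => hn (natCast_mem_exponents.1 h)
  · ext n
    by_cases hn : n ∈ exponents H
    · obtain ⟨m, -, rfl⟩ := hn
      rw [algebraMap_semigroupRing_apply, LaurentSeries.coeff_coe_powerSeries,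
        PowerSeries.coeff_mk]
    · rw [hx n hn]
      exact algebraMap_mem_supportedIn _ n hn

theorem algebraMap_semigroupRing_injective :
    Function.Injective (algebraMap (semigroupRing k H) k⸨X⸩) :=
  FaithfulSMul.algebraMap_injective _ _

theorem smul_mem_supportedIn {T : Set ℤ} (hT : ∀ h ∈ exponents H, ∀ t ∈ T, h + t ∈ T)
    (r : semigroupRing k H) {x : k⸨X⸩} (hx : x ∈ supportedIn k T) : r • x ∈ supportedIn k T := by
  rw [Algebra.smul_def]
  exact mul_mem_supportedIn hT (algebraMap_mem_supportedIn r) hx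

theorem mem_maximalIdeal_iff_coeff_zero {r : semigroupRing k H} :
    r ∈ IsLocalRing.maximalIdeal (semigroupRing k H) ↔
      (algebraMap (semigroupRing k H) k⸨X⸩ r).coeff 0 = 0 := by
  let ev : semigroupRing k H →+* k :=
    PowerSeries.constantCoeff.comp (semigroupRing k H).val.toRingHom
  have hev : Function.Surjective ev := fun c =>
    ⟨algebraMap k _ c, by
      change PowerSeries.constantCoeff (algebraMap k k⟦X⟧ c) = c
      rw [PowerSeries.algebraMap_apply]
      simp⟩
  have hmax : (RingHom.ker ev).IsMaximal := RingHom.ker_isMaximal_of_surjective ev hev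
  rw [← IsLocalRing.eq_maximalIdeal hmax, RingHom.mem_ker, algebraMap_semigroupRing_apply,
    show (0 : ℤ) = ((0 : ℕ) : ℤ) from rfl, LaurentSeries.coeff_coe_powerSeries,
    PowerSeries.coeff_zero_eq_constantCoeff]
  rfl

theorem algebraMap_mem_supportedIn_of_mem_maximalIdeal {r : semigroupRing k H}
    (hr : r ∈ IsLocalRing.maximalIdeal (semigroupRing k H)) :
    algebraMap (semigroupRing k H) k⸨X⸩ r ∈ supportedIn k (exponents H ∩ Set.Ici 1) := by
  intro n hn
  by_cases h0 : n = 0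
  · rw [h0]
    exact mem_maximalIdeal_iff_coeff_zero.1 hr
  · refine algebraMap_mem_supportedIn r n fun h => hn ⟨h, ?_⟩
    have := nonneg_of_mem_exponents h
    rw [Set.mem_Ici]
    omega

theorem supportedIn_Ici_le {f : ℕ} (hlarge : ∀ n, f < n → n ∈ H) :
    supportedIn k (Set.Ici ((f : ℤ) + 1)) ≤ supportedIn k (exponents H) :=
  supportedIn_mono fun _ hn => mem_exponents_of_lt hlarge (Int.lt_of_add_one_le hn)

/-- A nonzero element of an ideal divides, with quotient of given order, all elements of high
order. -/
theorem exists_forall_supportedIn_eq_mul {x : k⸨X⸩} (hx : x ≠ 0) (M : ℤ) :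
    ∃ N : ℤ, ∀ v ∈ supportedIn k (Set.Ici N), ∃ w ∈ supportedIn k (Set.Ici M), v = w * x := by
  obtain ⟨m, hm⟩ := exists_mem_supportedIn_Ici x⁻¹
  refine ⟨M - m, fun v hv => ⟨v * x⁻¹, mul_mem_supportedIn (fun s hs t ht => ?_) hv hm, ?_⟩⟩
  · rw [Set.mem_Ici] at *
    omega
  · rw [mul_assoc, inv_mul_cancel₀ hx, mul_one]

/-- The exponents `n` with `f - n ∉ H`. -/
def dualExponents (H : AddSubmonoid ℕ) (f : ℕ) : Set ℤ := {n | (f : ℤ) - n ∉ exponents H}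

theorem add_mem_dualExponents {f : ℕ} (h : ℤ) (hh : h ∈ exponents H) (n : ℤ)
    (hn : n ∈ dualExponents H f) : h + n ∈ dualExponents H f := fun hc => hn (by
  have := add_mem_exponents hh hc
  rwa [show h + ((f : ℤ) - (h + n)) = f - n by ring] at this)

variable (k H) in
/-- The canonical fractional ideal of `k[[H]]` inside `k((t))`. -/
def canonicalFractional (f : ℕ) : Submodule (semigroupRing k H) k⸨X⸩ where
  __ := (supportedIn k (dualExponents H f)).toAddSubmonoid
  smul_mem' r _ hx := smul_mem_supportedIn add_mem_dualExponents r hx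

theorem mem_canonicalFractional {f : ℕ} {x : k⸨X⸩} :
    x ∈ canonicalFractional k H f ↔ x ∈ supportedIn k (dualExponents H f) := Iff.rfl

/-- Multiplying by t^{f-n}, where f - n ∈ H, moves the coefficient at n to f. So K is the largest
R-submodule of k((t)) on which the coefficient of t^f vanishes. -/
theorem mem_canonicalFractional_iff_forall {f : ℕ} {x : k⸨X⸩} :
    x ∈ canonicalFractional k H f ↔ ∀ r : semigroupRing k H, (r • x).coeff f = 0 := by
  constructor
  · intro hx r
    exact (canonicalFractional k H f).smul_mem r hx f fun h => h (by
      rw [sub_self]; exact zero_mem_exponents)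
  · intro hx n hn
    have hn' : (f : ℤ) - n ∈ exponents H := not_not.1 hn
    obtain ⟨r, hr⟩ := exists_algebraMap_eq (single_mem_supportedIn hn' (1 : k))
    have := hx r
    rwa [Algebra.smul_def, hr, HahnSeries.coeff_single_mul, one_mul, sub_sub_cancel] at this

theorem supportedIn_Ici_le_canonicalFractional {f : ℕ} {x : k⸨X⸩}
    (hx : x ∈ supportedIn k (Set.Ici ((f : ℤ) + 1))) : x ∈ canonicalFractional k H f :=
  supportedIn_mono (T := dualExponents H f) (fun n (hn : _ ≤ n) hc => by
    have := nonneg_of_mem_exponents hc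
    omega) hx

theorem exists_linearMap_comp_eq {V W : Type*} [AddCommGroup V] [Module k V] [AddCommGroup W]
    [Module k W] (i : V →ₗ[k] W) (g : V →ₗ[k] k) (h : ∀ v, i v = 0 → g v = 0) :
    ∃ ψ : W →ₗ[k] k, ∀ v, ψ (i v) = g v := by
  have : g ∈ LinearMap.range i.dualMap := by
    rw [LinearMap.range_dualMap_eq_dualAnnihilator_ker, Submodule.mem_dualAnnihilator]
    exact h
  obtain ⟨ψ, hψ⟩ := this
  exact ⟨ψ, fun v => LinearMap.congr_fun hψ v⟩

theorem exists_linearMap_quotient_canonicalFractional (f : ℕ) :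
    ∃ lam : (k⸨X⸩ ⧸ canonicalFractional k H f) →ₗ[k] k,
      ∀ x : k⸨X⸩, lam (Submodule.Quotient.mk x) = x.coeff f := by
  let top : k⸨X⸩ →ₗ[k] k :=
    { toFun := fun x => x.coeff f
      map_add' := fun _ _ => rfl
      map_smul' := fun _ _ => rfl }
  exact ⟨(((canonicalFractional k H f).restrictScalars k).liftQ top (fun x hx => by
      have := mem_canonicalFractional_iff_forall.1 hx 1
      rwa [one_smul] at this)).comp
    (Submodule.Quotient.restrictScalarsEquiv k (canonicalFractional k H f)).symm.toLinearMap,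
    fun x => rfl⟩

set_option maxHeartbeats 1000000 in
-- Matlis duality with λ = coefficient of t^f: a map φ from an ideal J to k((t))/K is recovered from
-- λ ∘ φ. As φ kills elements of high order, λ ∘ φ extends to a k-functional on k((t)) of the form x
-- ↦ (yx)_f. Then φ(j) is the class of jy, since λ vanishes on every R-multiple of the difference.
theorem injective_quotient_canonicalFractional {f : ℕ} (hlarge : ∀ n, f < n → n ∈ H) :
    Module.Injective (semigroupRing k H) (k⸨X⸩ ⧸ canonicalFractional k H f) := by
  set K := canonicalFractional k H f with hKdef
  refine Module.Baer.injective fun J φ => ?_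
  by_cases hJ : J = ⊥
  · refine ⟨0, fun x hx => ?_⟩
    subst hJ
    have : (⟨x, hx⟩ : (⊥ : Ideal (semigroupRing k H))) = 0 := Subsingleton.elim _ _
    rw [this, map_zero, LinearMap.zero_apply]
  obtain ⟨x, hx, hx0⟩ := Submodule.exists_mem_ne_zero_of_ne_bot hJ
  have hx0' : algebraMap (semigroupRing k H) k⸨X⸩ x ≠ 0 := by
    rwa [Ne, FaithfulSMul.algebraMap_eq_zero_iff]
  obtain ⟨w, hw⟩ := Submodule.Quotient.mk_surjective K (φ ⟨x, hx⟩)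
  obtain ⟨m, hm⟩ := exists_mem_supportedIn_Ici w
  -- An element of order at least N is v x with v of order above f, so that v ∈ R, and above f - m,
  -- so that v w ∈ K.
  obtain ⟨N, hN⟩ := exists_forall_supportedIn_eq_mul hx0' (max (f + 1) (f + 1 - m))
  have hφN : ∀ j : J, algebraMap (semigroupRing k H) k⸨X⸩ j ∈ supportedIn k (Set.Ici N) →
      φ j = 0 := by
    intro j hj
    obtain ⟨v, hv, hvj⟩ := hN _ hj
    obtain ⟨r, rfl⟩ := exists_algebraMap_eq (supportedIn_Ici_le hlarge
      (supportedIn_mono (Set.Ici_subset_Ici.2 (le_max_left _ _)) hv))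
    rw [← map_mul] at hvj
    have : j = r • ⟨x, hx⟩ := Subtype.ext (algebraMap_semigroupRing_injective hvj)
    rw [this, map_smul, ← hw, ← Submodule.Quotient.mk_smul, Submodule.Quotient.mk_eq_zero,
      Algebra.smul_def]
    refine supportedIn_Ici_le_canonicalFractional (mul_mem_supportedIn (fun s hs t ht => ?_) hv hm)
    rw [Set.mem_Ici] at *
    have := (le_max_right _ _).trans hs
    omega
  obtain ⟨lam, hlam⟩ : ∃ lam : (k⸨X⸩ ⧸ K) →ₗ[k] k,
      ∀ x : k⸨X⸩, lam (Submodule.Quotient.mk x) = x.coeff f :=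
    exists_linearMap_quotient_canonicalFractional f
  let i : J →ₗ[k] (k⸨X⸩ ⧸ supportedIn k (Set.Ici N)) :=
    (supportedIn k (Set.Ici N)).mkQ.comp
      (((Algebra.linearMap (semigroupRing k H) k⸨X⸩).comp J.subtype).restrictScalars k)
  obtain ⟨ψ, hψ⟩ := exists_linearMap_comp_eq i (lam.comp (φ.restrictScalars k)) (fun j hj => by
    have h1 : algebraMap (semigroupRing k H) k⸨X⸩ j ∈ supportedIn k (Set.Ici N) :=
      (Submodule.Quotient.mk_eq_zero _).1 hj
    rw [LinearMap.comp_apply, LinearMap.restrictScalars_apply, hφN j h1, map_zero])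
  obtain ⟨y, hy⟩ := exists_forall_eq_coeff_mul (f : ℤ) N
    (ψ.comp (supportedIn k (Set.Ici N)).mkQ) (fun x hx => by
      rw [LinearMap.comp_apply, Submodule.mkQ_apply, (Submodule.Quotient.mk_eq_zero _).2 hx,
        map_zero])
  have hyJ : ∀ j : J, (y * algebraMap (semigroupRing k H) k⸨X⸩ j).coeff f = lam (φ j) :=
    fun j => (hy _).symm.trans (hψ j)
  refine ⟨LinearMap.toSpanSingleton _ _ (Submodule.Quotient.mk y), fun j hj => ?_⟩
  obtain ⟨v, hv⟩ := Submodule.Quotient.mk_surjective K (φ ⟨j, hj⟩)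
  rw [LinearMap.toSpanSingleton_apply, ← hv, ← Submodule.Quotient.mk_smul, Submodule.Quotient.eq,
    mem_canonicalFractional_iff_forall]
  intro r
  have h1 := hyJ (r • ⟨j, hj⟩)
  rw [map_smul, ← hv, ← Submodule.Quotient.mk_smul, hlam] at h1
  rw [smul_sub, HahnSeries.coeff_sub, ← h1, sub_eq_zero]
  congr 1
  change r • (j • y) = y * algebraMap (semigroupRing k H) k⸨X⸩ (r * j)
  rw [smul_smul, Algebra.smul_def, mul_comm]

end SemigroupRing

/-! ### Canonical ideals as the multiples βK. -/

section CanonicalIdeals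

open IsLocalRing

variable {k : Type u} [Field k] {H : AddSubmonoid ℕ}

theorem eq_zero_of_forall_maximalIdeal_smul_eq_zero {f : ℕ} (hlarge : ∀ n, f < n → n ∈ H)
    (x : k⸨X⸩) (hx : ∀ r ∈ maximalIdeal (semigroupRing k H), r • x = 0) : x = 0 := by
  obtain ⟨r, hr⟩ := exists_algebraMap_eq (single_mem_supportedIn
    (natCast_mem_exponents.2 (hlarge (f + 1) (Nat.lt_succ_self f))) (1 : k))
  have hrm : r ∈ maximalIdeal (semigroupRing k H) := by
    rw [mem_maximalIdeal_iff_coeff_zero, hr]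
    exact HahnSeries.coeff_single_of_ne (by positivity)
  have h := hx r hrm
  rw [Algebra.smul_def, hr, mul_eq_zero] at h
  exact h.resolve_left (HahnSeries.single_ne_zero one_ne_zero)

variable (k H) in
/-- The inclusion of an ideal of `k[[H]]` into `k((t))`. -/
abbrev idealToLaurent (I : Ideal (semigroupRing k H)) : I →ₗ[semigroupRing k H] k⸨X⸩ :=
  (Algebra.linearMap (semigroupRing k H) k⸨X⸩).comp I.subtype

theorem idealToLaurent_injective (I : Ideal (semigroupRing k H)) :
    Function.Injective (idealToLaurent k H I) :=
  algebraMap_semigroupRing_injective.comp Subtype.val_injective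

theorem mem_range_idealToLaurent {I : Ideal (semigroupRing k H)} {x : k⸨X⸩} :
    x ∈ LinearMap.range (idealToLaurent k H I) ↔
      ∃ r ∈ I, algebraMap (semigroupRing k H) k⸨X⸩ r = x :=
  ⟨fun ⟨⟨r, hr⟩, e⟩ => ⟨r, hr, e⟩, fun ⟨r, hr, e⟩ => ⟨⟨r, hr⟩, e⟩⟩

/-- An ideal of type one is, inside `k((t))`, a multiple of the canonical fractional ideal. -/
theorem exists_forall_mem_canonicalFractional_iff {f : ℕ} (hlarge : ∀ n, f < n → n ∈ H)
    (I : Ideal (semigroupRing k H))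
    (hI : Module.length (semigroupRing k H) (ResidueExt (semigroupRing k H) I 1) = 1) :
    ∃ β : k⸨X⸩, β ≠ 0 ∧ ∀ x, (∃ r ∈ I, algebraMap (semigroupRing k H) k⸨X⸩ r = β * x) ↔
      x ∈ canonicalFractional k H f := by
  have hF := eq_zero_of_forall_maximalIdeal_smul_eq_zero (k := k) hlarge
  have := injective_of_field (semigroupRing k H) k⸨X⸩
  rw [length_residueExt_one_eq_one_iff hF _ (idealToLaurent_injective I)] at hI
  obtain ⟨z, hz, hmz, hgen⟩ := hI
  simp only [← mem_range_idealToLaurent]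
  generalize hL : LinearMap.range (idealToLaurent k H I) = L at *
  have hI0 : I ≠ ⊥ := by
    rintro rfl
    have hL0 : ∀ w ∈ L, w = 0 := by
      intro w hw
      rw [← hL, mem_range_idealToLaurent] at hw
      obtain ⟨r, hr, rfl⟩ := hw
      rw [(Submodule.mem_bot _).1 hr, map_zero]
    exact hz (hF z (fun r hr => hL0 _ (hmz r hr)) ▸ L.zero_mem)
  obtain ⟨x, hx, hx0⟩ := Submodule.exists_mem_ne_zero_of_ne_bot hI0
  have hx0' : algebraMap (semigroupRing k H) k⸨X⸩ x ≠ 0 := by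
    rwa [Ne, FaithfulSMul.algebraMap_eq_zero_iff]
  obtain ⟨N, hN⟩ := exists_forall_supportedIn_eq_mul hx0' (f + 1)
  have hNL : ∀ v ∈ supportedIn k (Set.Ici N), v ∈ L := by
    intro v hv
    obtain ⟨w, hw, rfl⟩ := hN v hv
    obtain ⟨r, rfl⟩ := exists_algebraMap_eq (supportedIn_Ici_le hlarge hw)
    rw [← hL, mem_range_idealToLaurent]
    exact ⟨r * x, I.mul_mem_left r hx, map_mul _ _ _⟩
  -- A functional that separates the socle generator z from L is x ↦ (yx)_f, and β = y⁻¹ works: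
  -- since ψ vanishes on the R-module L, yL ⊆ K.
  obtain ⟨ψ, hψz, hψL⟩ : ∃ ψ : k⸨X⸩ →ₗ[k] k, ψ z ≠ 0 ∧ ∀ w ∈ L, ψ w = 0 := by
    obtain ⟨ψ, h1, h2⟩ := Submodule.exists_le_ker_of_notMem (p := L.restrictScalars k) hz
    exact ⟨ψ, h1, fun w hw => h2 hw⟩
  obtain ⟨y, hy⟩ := exists_forall_eq_coeff_mul (f : ℤ) N ψ fun x hx => hψL x (hNL x hx)
  have hy0 : y ≠ 0 := by
    rintro rfl
    rw [hy, zero_mul] at hψz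
    exact hψz rfl
  refine ⟨y⁻¹, inv_ne_zero hy0, fun x => ⟨fun hx => ?_, fun hx => ?_⟩⟩
  · rw [mem_canonicalFractional_iff_forall]
    intro r
    rw [← hψL _ (L.smul_mem r hx), hy, Algebra.smul_def, Algebra.smul_def, mul_left_comm,
      mul_inv_cancel_left₀ hy0]
  · by_contra hw
    -- Among the multiples of y⁻¹x outside L, one of greatest order bound is sent into L by 𝔪, hence
    -- is a unit multiple of z modulo L. But ψ vanishes on all these multiples, as x ∈ K, and not on
    -- z.
    let P : ℤ → Prop := fun n => ∃ r : semigroupRing k H, r • (y⁻¹ * x) ∉ L ∧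
      r • (y⁻¹ * x) ∈ supportedIn k (Set.Ici n)
    obtain ⟨n, ⟨r, hrL, hrn⟩, hmax⟩ := Int.exists_greatest_of_bdd (P := P)
      ⟨N, fun n ⟨r, h1, h2⟩ => by
        by_contra hlt
        exact h1 (hNL _ (supportedIn_mono (Set.Ici_subset_Ici.2 (not_le.1 hlt).le) h2))⟩
      (by
        obtain ⟨n, hn⟩ := exists_mem_supportedIn_Ici (y⁻¹ * x)
        exact ⟨n, 1, by rwa [one_smul], by rwa [one_smul]⟩)
    have hm : ∀ s ∈ maximalIdeal (semigroupRing k H), s • r • (y⁻¹ * x) ∈ L := by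
      intro s hs
      by_contra hc
      refine absurd (hmax (n + 1) ⟨s * r, by rwa [mul_smul], ?_⟩) (by omega)
      rw [mul_smul, Algebra.smul_def]
      refine mul_mem_supportedIn (fun i hi j hj => ?_)
        (algebraMap_mem_supportedIn_of_mem_maximalIdeal hs) hrn
      have := hi.2
      rw [Set.mem_Ici] at *
      omega
    obtain ⟨c, hc⟩ := hgen _ hm
    have hcu : IsUnit c := by
      by_contra h
      exact hrL ((L.sub_mem_iff_left (hmz c h)).1 hc)
    obtain ⟨c, rfl⟩ := hcu
    have h1 := hψL _ (L.smul_mem (↑c⁻¹ : semigroupRing k H) hc)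
    rw [smul_sub, smul_smul, smul_smul, Units.inv_mul, one_smul, map_sub, sub_eq_zero, hy,
      Algebra.smul_def, mul_left_comm, mul_inv_cancel_left₀ hy0, ← Algebra.smul_def,
      mem_canonicalFractional_iff_forall.1 hx] at h1
    exact hψz h1.symm

/-- If an ideal is generated, inside `k((t))`, by a multiple of the canonical fractional ideal,
then it is a canonical module. -/
theorem isCanonicalModule_of_forall_mem_iff {f : ℕ} (hlarge : ∀ n, f < n → n ∈ H)
    (I : Ideal (semigroupRing k H)) (hfin : Module.Finite (semigroupRing k H) I)
    {β : k⸨X⸩} (hβ : β ≠ 0)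
    (hI : ∀ x, (∃ r ∈ I, algebraMap (semigroupRing k H) k⸨X⸩ r = β * x) ↔
      x ∈ canonicalFractional k H f) :
    IsCanonicalModule (semigroupRing k H) I := by
  have hF := eq_zero_of_forall_maximalIdeal_smul_eq_zero (k := k) hlarge
  have := injective_of_field (semigroupRing k H) k⸨X⸩
  let e : k⸨X⸩ ≃ₗ[semigroupRing k H] k⸨X⸩ :=
    { toFun := fun x => β * x
      invFun := fun x => β⁻¹ * x
      left_inv := fun x => inv_mul_cancel_left₀ hβ x
      right_inv := fun x => mul_inv_cancel_left₀ hβ x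
      map_add' := fun x y => mul_add _ _ _
      map_smul' := fun r x => by
        rw [Algebra.smul_def, mul_left_comm, ← Algebra.smul_def, RingHom.id_apply] }
  have hmem : ∀ x, β * x ∈ LinearMap.range (idealToLaurent k H I) ↔
      x ∈ canonicalFractional k H f := fun x => by rw [mem_range_idealToLaurent, hI]
  have hmem' : ∀ x, x ∈ LinearMap.range (idealToLaurent k H I) ↔
      β⁻¹ * x ∈ canonicalFractional k H f := fun x => by
    rw [← hmem, mul_inv_cancel_left₀ hβ]
  -- The socle of k((t))/βK is generated by β t^f: f ∉ T because 0 ∈ H, and positive elements of H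
  -- push f into T. If 𝔪w ⊆ βK, testing with t^{f-n} kills every coefficient of β⁻¹w outside T
  -- except the one at f.
  refine isCanonicalModule_of_injective hF _ (idealToLaurent_injective I) ?_
    ⟨β * HahnSeries.single (f : ℤ) 1, ?_, fun r hr => ?_, fun w hw => ?_⟩
  · have hKinj := injective_quotient_canonicalFractional (k := k) hlarge
    have hmap : (canonicalFractional k H f).map e.toLinearMap =
        LinearMap.range (idealToLaurent k H I) := by
      ext x
      rw [hmem', Submodule.mem_map]
      constructor
      · rintro ⟨y, hy, rfl⟩
        change β⁻¹ * (β * y) ∈ _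
        rwa [inv_mul_cancel_left₀ hβ]
      · intro hx
        exact ⟨_, hx, mul_inv_cancel_left₀ hβ x⟩
    exact ((Module.Baer.of_injective hKinj).of_equiv
      (Submodule.Quotient.equiv (canonicalFractional k H f) _ e hmap)).injective
  · rw [hmem, mem_canonicalFractional]
    intro h
    have := h f (fun h' => h' (by rw [sub_self]; exact zero_mem_exponents))
    rw [HahnSeries.coeff_single_same] at this
    exact one_ne_zero this
  · rw [Algebra.smul_def, mul_left_comm, hmem, mem_canonicalFractional]
    refine mul_mem_supportedIn (T := {(f : ℤ)}) (fun s hs t ht => ?_)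
      (algebraMap_mem_supportedIn_of_mem_maximalIdeal hr) 
      (single_mem_supportedIn (Set.mem_singleton (f : ℤ)) (1 : k))
    intro hc
    have h1 := nonneg_of_mem_exponents hc
    have h2 := hs.2
    rw [Set.mem_singleton_iff] at ht
    rw [Set.mem_Ici] at h2
    omega
  · obtain ⟨c, hc⟩ := exists_algebraMap_eq (k := k) (H := H)
      (single_mem_supportedIn zero_mem_exponents ((β⁻¹ * w).coeff f))
    refine ⟨c, ?_⟩
    rw [hmem', mul_sub, Algebra.smul_def, mul_left_comm, inv_mul_cancel_left₀ hβ, hc,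
      HahnSeries.single_mul_single, zero_add, mul_one, mem_canonicalFractional]
    intro n hn
    by_cases hnf : n = f
    · rw [hnf, HahnSeries.coeff_sub, HahnSeries.coeff_single_same, sub_self]
    · rw [HahnSeries.coeff_sub, HahnSeries.coeff_single_of_ne hnf, sub_zero]
      have hn' : (f : ℤ) - n ∈ exponents H := not_not.1 hn
      obtain ⟨r, hr⟩ := exists_algebraMap_eq (single_mem_supportedIn hn' (1 : k))
      have hrm : r ∈ maximalIdeal (semigroupRing k H) := by
        rw [mem_maximalIdeal_iff_coeff_zero, hr]
        exact HahnSeries.coeff_single_of_ne (by omega)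
      have h1 := hw r hrm
      rw [hmem', Algebra.smul_def, mul_left_comm, ← Algebra.smul_def] at h1
      have h2 := mem_canonicalFractional_iff_forall.1 h1 1
      rwa [one_smul, Algebra.smul_def, hr, HahnSeries.coeff_single_mul, one_mul,
        sub_sub_cancel] at h2

end CanonicalIdeals

/-! ### The Sally rank as the number of elements of H' outside T. -/

section SallyRankComputation

variable {k : Type u} [Field k] {H H' : AddSubmonoid ℕ} {T : Set ℤ}

/-- The ideal of all elements of the form `γ v` with `v` supported in `U`. -/
def supportIdeal (γ : k⸨X⸩) (U : Set ℤ) (hU : ∀ h ∈ exponents H, ∀ t ∈ U, h + t ∈ U) :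
    Ideal (semigroupRing k H) where
  carrier := {r | γ⁻¹ * algebraMap (semigroupRing k H) k⸨X⸩ r ∈ supportedIn k U}
  add_mem' {r s} hr hs := by
    change γ⁻¹ * algebraMap (semigroupRing k H) k⸨X⸩ (r + s) ∈ supportedIn k U
    rw [map_add, mul_add]
    exact Submodule.add_mem _ hr hs
  zero_mem' := by
    change γ⁻¹ * algebraMap (semigroupRing k H) k⸨X⸩ 0 ∈ supportedIn k U
    rw [map_zero, mul_zero]
    exact Submodule.zero_mem _
  smul_mem' r s hs := by
    change γ⁻¹ * algebraMap (semigroupRing k H) k⸨X⸩ (r * s) ∈ supportedIn k U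
    rw [map_mul, mul_left_comm, ← Algebra.smul_def]
    exact smul_mem_supportedIn hU r hs

theorem mem_supportIdeal {γ : k⸨X⸩} {U : Set ℤ}
    {hU : ∀ h ∈ exponents H, ∀ t ∈ U, h + t ∈ U} {r : semigroupRing k H} :
    r ∈ supportIdeal γ U hU ↔
      γ⁻¹ * algebraMap (semigroupRing k H) k⸨X⸩ r ∈ supportedIn k U := Iff.rfl

/-- The exponents in `T`, together with the elements of `H'` that are at least `c`. -/
def truncation (H' : AddSubmonoid ℕ) (T : Set ℤ) (c : ℕ) : Set ℤ :=
  T ∪ (exponents H' ∩ Set.Ici (c : ℤ))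

theorem natCast_mem_truncation {c : ℕ} {n : ℕ} :
    (n : ℤ) ∈ truncation H' T c ↔ (n : ℤ) ∈ T ∨ (n ∈ H' ∧ c ≤ n) := by
  rw [truncation, Set.mem_union, Set.mem_inter_iff, natCast_mem_exponents, Set.mem_Ici,
    Nat.cast_le]

theorem truncation_succ_subset (c : ℕ) : truncation H' T (c + 1) ⊆ truncation H' T c := by
  rintro n (h | ⟨h, h'⟩)
  · exact Or.inl h
  · refine Or.inr ⟨h, ?_⟩
    rw [Set.mem_Ici] at *
    push_cast at h'
    omega

theorem mem_truncation_succ {c : ℕ} {n : ℤ} (h : n ∈ truncation H' T c) (hn : n ≠ c) :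
    n ∈ truncation H' T (c + 1) := by
  rcases h with h | ⟨h, h'⟩
  · exact Or.inl h
  · refine Or.inr ⟨h, ?_⟩
    rw [Set.mem_Ici] at *
    push_cast
    omega

theorem add_mem_truncation (hH : H ≤ H') (hT : ∀ h ∈ exponents H, ∀ t ∈ T, h + t ∈ T) (c : ℕ) :
    ∀ h ∈ exponents H, ∀ t ∈ truncation H' T c, h + t ∈ truncation H' T c := by
  rintro h hh t (ht | ⟨ht, htc⟩)
  · exact Or.inl (hT h hh t ht)
  · have h0 := nonneg_of_mem_exponents hh
    obtain ⟨m, hm, rfl⟩ := hh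
    refine Or.inr ⟨add_mem_exponents ⟨m, hH hm, rfl⟩ ht, ?_⟩
    rw [Set.mem_Ici] at *
    omega

theorem sub_single_mem_supportedIn (r : k⸨X⸩) (c : ℤ) {U U' : Set ℤ} (h : ∀ n ∈ U, n ≠ c → n ∈ U')
    (hr : r ∈ supportedIn k U) : r - HahnSeries.single c (r.coeff c) ∈ supportedIn k U' := by
  intro n hn
  by_cases hnc : n = c
  · rw [hnc, HahnSeries.coeff_sub, HahnSeries.coeff_single_same, sub_self]
  · rw [HahnSeries.coeff_sub, HahnSeries.coeff_single_of_ne hnc, sub_zero]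
    exact hr n fun h' => hn (h n h' hnc)

/-- Passing from c to c + 1 removes only the exponent c, where r t^c has the constant term of r as
coefficient. -/
theorem mul_single_mem_truncation_succ_iff (hH : H ≤ H') {c : ℕ} (hc : c ∈ H') (hcT : (c : ℤ) ∉ T)
    (r : semigroupRing k H) :
    algebraMap (semigroupRing k H) k⸨X⸩ r * HahnSeries.single (c : ℤ) 1 ∈
      supportedIn k (truncation H' T (c + 1)) ↔
      r ∈ IsLocalRing.maximalIdeal (semigroupRing k H) := by
  constructor
  · intro h
    have h2 := h c (fun hc' => by
      rcases natCast_mem_truncation.1 hc' with hc' | hc'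
      · exact hcT hc'
      · omega)
    rw [HahnSeries.coeff_mul_single, sub_self, mul_one] at h2
    exact mem_maximalIdeal_iff_coeff_zero.2 h2
  · intro hr
    refine mul_mem_supportedIn (fun i hi j hj => Or.inr ⟨?_, ?_⟩)
      (algebraMap_mem_supportedIn_of_mem_maximalIdeal hr)
      (single_mem_supportedIn (Set.mem_singleton (c : ℤ)) (1 : k))
    · obtain ⟨⟨m, hm, rfl⟩, -⟩ := hi
      rw [Set.mem_singleton_iff.1 hj]
      exact add_mem_exponents ⟨m, hH hm, rfl⟩ (natCast_mem_exponents.2 hc)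
    · have h2 := hi.2
      rw [Set.mem_singleton_iff] at hj
      rw [Set.mem_Ici] at *
      push_cast
      omega

set_option maxHeartbeats 1000000 in
/-- Let the ideal `I` be, inside `k((t))`, of the form `β L` where `L` consists of the series
supported in `T`. If `I^{n+1} ⊆ α^n β k[[H']]` for all `n`, with equality for some `n`, then the
rank of the Sally module is the number of elements of `H'` outside `T`. -/
theorem sallyRank_semigroupRing (hH : H ≤ H')
    (hT : ∀ h ∈ exponents H, ∀ t ∈ T, h + t ∈ T) {I : Ideal (semigroupRing k H)}
    {α : semigroupRing k H} (hα : α ∈ nonZeroDivisors (semigroupRing k H)) (hαI : α ∈ I)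
    {β : k⸨X⸩} (hβ : β ≠ 0)
    (hI : ∀ x, (∃ r ∈ I, algebraMap (semigroupRing k H) k⸨X⸩ r = β * x) ↔ x ∈ supportedIn k T)
    (hpow : ∀ n, ∀ r ∈ I ^ (n + 1), (algebraMap (semigroupRing k H) k⸨X⸩ α ^ n * β)⁻¹ *
      algebraMap (semigroupRing k H) k⸨X⸩ r ∈ supportedIn k (exponents H'))
    (hgen : ∃ n, ∀ v ∈ supportedIn k (exponents H'), ∃ r ∈ I ^ (n + 1),
      algebraMap (semigroupRing k H) k⸨X⸩ r =
        algebraMap (semigroupRing k H) k⸨X⸩ α ^ n * β * v)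
    (Δ : Finset ℕ) (hΔ : ∀ n : ℕ, n ∈ Δ ↔ n ∈ H' ∧ (n : ℤ) ∉ T) :
    sallyRank I α hα = Δ.card := by
  have hα' : algebraMap (semigroupRing k H) k⸨X⸩ α ≠ 0 := by
    rw [Ne, FaithfulSMul.algebraMap_eq_zero_iff]
    exact nonZeroDivisors.ne_zero hα
  have hαβ : ∀ n : ℕ, algebraMap (semigroupRing k H) k⸨X⸩ α ^ n * β ≠ 0 := fun n =>
    mul_ne_zero (pow_ne_zero _ hα') hβ
  obtain ⟨C, hC⟩ : ∃ C, ∀ c ∈ Δ, c < C := ⟨Δ.sup id + 1, fun c hc =>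
    Nat.lt_succ_of_le (Finset.le_sup (f := id) hc)⟩
  obtain ⟨N, hN⟩ := hgen
  -- The c-th filtration step is, in degree n, the elements of R in α^n β times the series supported
  -- in T ∪ (H' ∩ [c, ∞)). It contains I^{n+1} for c = 0, is contained in α^n I for c = C, and can
  -- drop only at c ∈ Δ.
  refine sallyRank_eq_card hα hαI
    (fun c n => supportIdeal (algebraMap (semigroupRing k H) k⸨X⸩ α ^ n * β) _
      (add_mem_truncation hH hT c)) (fun c n r hr => ?_) (fun c r hr => ?_) (fun c n r hr => ?_)
    (fun n r hr => ?_) C (fun n r hr => ?_) Δ hC (fun c hc n => ?_) (fun c hc => ?_)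
  · rw [mem_supportIdeal] at *
    convert hr using 1
    rw [map_mul, pow_succ]
    field_simp
  · rw [mem_supportIdeal, pow_zero, one_mul]
    refine supportedIn_mono Set.subset_union_left ((hI _).1 ⟨r, hr, ?_⟩)
    rw [mul_inv_cancel_left₀ hβ]
  · exact supportedIn_mono (truncation_succ_subset c) hr
  · refine supportedIn_mono (fun m hm => Or.inr ⟨hm, ?_⟩) (hpow n r hr)
    exact_mod_cast nonneg_of_mem_exponents hm
  · have h1 : truncation H' T C ⊆ T := by
      rintro m (hm | ⟨⟨m, hm, rfl⟩, hmC⟩)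
      · exact hm
      · by_contra h
        have := hC m ((hΔ m).2 ⟨hm, h⟩)
        rw [Set.mem_Ici] at hmC
        omega
    obtain ⟨d, hd, hdr⟩ := (hI _).2 (supportedIn_mono h1 hr)
    refine ⟨d, hd, algebraMap_semigroupRing_injective ?_⟩
    rw [map_mul, map_pow, hdr]
    field_simp
  · ext r
    rw [mem_supportIdeal, mem_supportIdeal]
    refine ⟨fun h => supportedIn_mono (fun m hm => ?_) h,
      fun h => supportedIn_mono (truncation_succ_subset c) h⟩
    by_cases hmc : m = c
    · subst hmc
      rw [natCast_mem_truncation] at *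
      by_contra h'
      rw [hΔ] at hc
      push Not at hc h'
      rcases hm with hm | hm
      · exact h'.1 hm
      · exact h'.1 (hc hm.1)
    · exact mem_truncation_succ hm hmc
  · rw [hΔ] at hc
    -- The jump at c is generated by r₀ = α^N β t^c, which lies in I^{N+1} by the equality in degree
    -- N.
    obtain ⟨r₀, hr₀I, hr₀⟩ := hN (HahnSeries.single (c : ℤ) 1)
      (single_mem_supportedIn (natCast_mem_exponents.2 hc.1) 1)
    refine ⟨N, r₀, hr₀I, ?_, fun n r => ?_, fun n y hy => ?_⟩
    · rw [mem_supportIdeal, hr₀, inv_mul_cancel_left₀ (hαβ N)]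
      exact single_mem_supportedIn (natCast_mem_truncation.2 (Or.inr ⟨hc.1, le_rfl⟩)) 1
    · rw [mem_supportIdeal, ← mul_single_mem_truncation_succ_iff hH hc.1 hc.2 r, map_mul, map_mul,
        map_pow, hr₀]
      have : (algebraMap (semigroupRing k H) k⸨X⸩ α ^ (n + N) * β)⁻¹ *
          (algebraMap (semigroupRing k H) k⸨X⸩ α ^ n * algebraMap (semigroupRing k H) k⸨X⸩ r *
          (algebraMap (semigroupRing k H) k⸨X⸩ α ^ N * β * HahnSeries.single (c : ℤ) 1)) =
          algebraMap (semigroupRing k H) k⸨X⸩ r * HahnSeries.single (c : ℤ) 1 := by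
        rw [inv_mul_eq_iff_eq_mul₀ (hαβ _)]
        ring
      rw [this]
    · rw [mem_supportIdeal] at hy
      obtain ⟨γ, hγ⟩ := exists_algebraMap_eq (single_mem_supportedIn
        (zero_mem_exponents (H := H)) (((algebraMap (semigroupRing k H) k⸨X⸩ α ^ n * β)⁻¹ *
        algebraMap (semigroupRing k H) k⸨X⸩ y).coeff c))
      refine ⟨γ, ?_⟩
      rw [mem_supportIdeal]
      convert sub_single_mem_supportedIn _ (c : ℤ) (fun m hm hmc => mem_truncation_succ hm hmc) hy using 1
      have h1 : HahnSeries.single (c : ℤ) (((algebraMap (semigroupRing k H) k⸨X⸩ α ^ n * β)⁻¹ *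
          algebraMap (semigroupRing k H) k⸨X⸩ y).coeff c) =
          algebraMap (semigroupRing k H) k⸨X⸩ γ * HahnSeries.single (c : ℤ) 1 := by
        rw [hγ, HahnSeries.single_mul_single, zero_add, mul_one]
      rw [h1, map_sub, map_mul, map_mul, map_mul, map_pow, map_pow, hr₀,
        inv_mul_eq_iff_eq_mul₀ (hαβ _), mul_sub, pow_add]
      field_simp

end SallyRankComputation

/-! ### The numerical semigroup: the counting argument and the exponents of K. -/

section Combinatorics

variable {ℓ : ℕ} {g : Fin ℓ → ℕ}

theorem gen_mem_semigroup (i : Fin ℓ) : g i ∈ semigroup g :=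
  AddSubmonoid.subset_closure (Set.mem_range_self i)

theorem eq_zero_or_exists_gen_add {x : ℕ} (hx : x ∈ semigroup g) :
    x = 0 ∨ ∃ i, ∃ y ∈ semigroup g, x = g i + y := by
  induction hx using AddSubmonoid.closure_induction with
  | mem x hx =>
    obtain ⟨i, rfl⟩ := hx
    exact Or.inr ⟨i, 0, zero_mem _, rfl⟩
  | zero => exact Or.inl rfl
  | add x y _ hy hx' hy' =>
    rcases hx' with rfl | ⟨i, z, hz, rfl⟩
    · rwa [zero_add]
    · exact Or.inr ⟨i, z + y, add_mem hz hy, add_assoc _ _ _⟩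

theorem mem_closure_of_lt_gen {i : Fin ℓ} {x : ℕ} (hx : x ∈ semigroup g) (hlt : x < g i) :
    x ∈ AddSubmonoid.closure (g '' {j | j ≠ i}) := by
  induction hx using AddSubmonoid.closure_induction with
  | mem x hx =>
    obtain ⟨j, rfl⟩ := hx
    exact AddSubmonoid.subset_closure ⟨j, fun h => lt_irrefl _ (h ▸ hlt), rfl⟩
  | zero => exact zero_mem _
  | add x y _ _ hx hy => exact add_mem (hx (by omega)) (hy (by omega))

/-- Minimal generators are atoms: two nonzero summands would both be smaller than g i, hence sums of
the other generators. -/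
theorem eq_zero_or_eq_zero_of_gen_eq_add
    (hmin : ∀ j, g j ∉ AddSubmonoid.closure (g '' {i | i ≠ j})) {i : Fin ℓ} {x y : ℕ}
    (hx : x ∈ semigroup g) (hy : y ∈ semigroup g) (h : g i = x + y) : x = 0 ∨ y = 0 := by
  by_contra hc
  push Not at hc
  refine hmin i ?_
  rw [h]
  exact add_mem (mem_closure_of_lt_gen hx (by omega)) (mem_closure_of_lt_gen hy (by omega))

/-- The combinatorial core: the set of `h ∈ H` such that `f - h` lies in the semigroup generated
by `H` and `a` has two elements if and only if `3a ∈ H` and `f = 2a + g i` for some `i`. -/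
theorem card_eq_two_iff (hpos : ∀ i, 0 < g i)
    (hmin : ∀ j, g j ∉ AddSubmonoid.closure (g '' {i | i ≠ j})) {f a : ℕ} (ha : 0 < a)
    (hf : f ∉ semigroup g)
    (hdual : ∀ n : ℤ, (f : ℤ) - n ∉ exponents (semigroup g) ↔
      n ∈ exponents (semigroup g) ∨ n - a ∈ exponents (semigroup g))
    (Γ : Finset ℕ) (hΓ : ∀ h, h ∈ Γ ↔ h ∈ semigroup g ∧ ∃ j, ∃ h' ∈ semigroup g,
      f = h + h' + j * a) :
    Γ.card = 2 ↔ 3 * a ∈ semigroup g ∧ ∃ i, f = 2 * a + g i := by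
  -- The exponent a occurs in K, so f - a ∉ H.
  have hfa : ∀ h ∈ semigroup g, f ≠ h + a := by
    intro h hh hc
    refine (hdual a).2 (Or.inr ?_) ⟨h, hh, by rw [hc]; push_cast; ring⟩
    rw [sub_self]
    exact zero_mem_exponents
  constructor
  · intro hcard
    obtain ⟨e, he, he0⟩ : ∃ e ∈ Γ, e ≠ 0 := Finset.exists_mem_ne (by omega) 0
    obtain ⟨heH, j, h', hh', hfe⟩ := (hΓ e).1 he
    obtain ⟨i, y, hy, rfl⟩ := (eq_zero_or_exists_gen_add heH).resolve_left he0
    -- Γ is closed under taking summands in H, since a discarded summand can be absorbed into h'.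
    -- Hence Γ = {0, g i}.
    have h0Γ : 0 ∈ Γ := (hΓ 0).2 ⟨zero_mem _, j, g i + y + h', add_mem heH hh', by omega⟩
    have hiΓ : g i ∈ Γ := (hΓ _).2 ⟨gen_mem_semigroup i, j, y + h', add_mem hy hh', by omega⟩
    have hall : ∀ x ∈ Γ, x = 0 ∨ x = g i := by
      intro x hx
      by_contra hc
      push Not at hc
      have hsub : ({0, g i, x} : Finset ℕ) ⊆ Γ := by
        intro z hz
        simp only [Finset.mem_insert, Finset.mem_singleton] at hz
        rcases hz with rfl | rfl | rfl <;> assumption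
      have h3 : ({0, g i, x} : Finset ℕ).card = 3 :=
        Finset.card_eq_three.2 ⟨0, g i, x, (hpos i).ne, hc.1.symm, hc.2.symm, rfl⟩
      have := Finset.card_le_card hsub
      omega
    have hall' : ∀ x ∈ semigroup g, ∀ j, f = g i + x + j * a → x = 0 := by
      intro x hx j hfx
      have := hall (g i + x) ((hΓ _).2 ⟨add_mem (gen_mem_semigroup i) hx, j, 0, zero_mem _, hfx⟩)
      have := hpos i
      omega
    have hfj : f = g i + j * a := by
      have := hall' (y + h') (add_mem hy hh') j (by omega)
      omega
    have hj0 : j ≠ 0 := by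
      rintro rfl
      rw [zero_mul, add_zero] at hfj
      exact hf (hfj ▸ gen_mem_semigroup i)
    have hj1 : j ≠ 1 := by
      rintro rfl
      exact hfa _ (gen_mem_semigroup i) (by omega)
    obtain ⟨j, rfl⟩ : ∃ j', j = j' + 2 := ⟨j - 2, by omega⟩
    -- Now f = g i + (j + 2)a. If j ≠ 0, then a + g i = f - (j + 1)a is not in H, or it would be a
    -- third element of Γ. Duality puts (j + 1)a or ja in H: the first contradicts f - a ∉ H, the
    -- second puts g i + ja in Γ.
    have hj : j = 0 := by
      by_contra hj
      by_cases hag : a + g i ∈ semigroup g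
      · have := hall (a + g i) ((hΓ _).2 ⟨hag, j + 1, 0, zero_mem _, by rw [hfj]; ring⟩)
        omega
      · have h1 : (f : ℤ) - ((j + 1) * a : ℕ) ∉ exponents (semigroup g) := by
          rwa [show (f : ℤ) - ((j + 1) * a : ℕ) = ((a + g i : ℕ) : ℤ) by
            rw [hfj]; push_cast; ring, natCast_mem_exponents]
        rcases (hdual _).1 h1 with h2 | h2
        · rw [natCast_mem_exponents] at h2
          exact hfa _ (add_mem (gen_mem_semigroup i) h2) (by rw [hfj]; ring)
        · rw [show (((j + 1) * a : ℕ) : ℤ) - a = ((j * a : ℕ) : ℤ) by push_cast; ring,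
            natCast_mem_exponents] at h2
          have := hall' _ h2 2 (by rw [hfj]; ring)
          rcases Nat.mul_eq_zero.1 this with h | h <;> omega
    subst hj
    refine ⟨?_, i, by omega⟩
    -- If f - 3a were in H it would be in Γ; the value 0 gives a = g i and f ∈ H, the value g i
    -- contradicts f = 2a + g i. So duality gives 3a ∈ H or 2a ∈ H, and the latter puts f in H.
    by_cases h1 : (f : ℤ) - ((3 * a : ℕ) : ℤ) ∈ exponents (semigroup g)
    · obtain ⟨h, hh, hfh⟩ := h1
      have hfh' : f = h + 0 + 3 * a := by omega
      rcases hall h ((hΓ h).2 ⟨hh, 3, 0, zero_mem _, hfh'⟩) with rfl | rfl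
      · have hag : a = g i := by omega
        refine absurd ?_ hf
        rw [hfj, hag]
        exact add_mem (gen_mem_semigroup i) (by
          rw [← smul_eq_mul]; exact nsmul_mem (gen_mem_semigroup i) _)
      · omega
    · rcases (hdual _).1 h1 with h2 | h2
      · exact natCast_mem_exponents.1 h2
      · rw [show ((3 * a : ℕ) : ℤ) - a = ((2 * a : ℕ) : ℤ) by push_cast; ring,
          natCast_mem_exponents] at h2
        refine absurd ?_ hf
        rw [hfj]
        exact add_mem (gen_mem_semigroup i) (by simpa using h2)
  · rintro ⟨h3a, i, hfi⟩
    -- Multiples of 3a are absorbed into h', leaving j < 3. The cases j = 0, 1 contradict f ∉ H and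
    -- f - a ∉ H; for j = 2, h + h' = g i is an atom.
    have key : ∀ j, ∀ h ∈ semigroup g, ∀ h' ∈ semigroup g, f = h + h' + j * a →
        h = 0 ∨ h = g i := by
      intro j
      induction j using Nat.strong_induction_on with
      | _ j ih =>
        intro h hh h' hh' hfj
        rcases Nat.lt_or_ge j 3 with hj | hj
        · interval_cases j
          · refine absurd ?_ hf
            rw [hfj, zero_mul, add_zero]
            exact add_mem hh hh'
          · exact absurd (by omega) (hfa _ (add_mem hh hh'))
          · have h1 : g i = h + h' := by omega
            rcases eq_zero_or_eq_zero_of_gen_eq_add hmin hh hh' h1 with h2 | h2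
            · exact Or.inl h2
            · exact Or.inr (by omega)
        · obtain ⟨j, rfl⟩ := Nat.exists_eq_add_of_le' hj
          exact ih j (by omega) h hh (h' + 3 * a) (add_mem hh' h3a) (by rw [hfj]; ring)
    have hΓ' : Γ = {0, g i} := by
      ext h
      rw [hΓ, Finset.mem_insert, Finset.mem_singleton]
      constructor
      · rintro ⟨hh, j, h', hh', hfj⟩
        exact key j h hh h' hh' hfj
      · rintro (rfl | rfl)
        · exact ⟨zero_mem _, 2, g i, gen_mem_semigroup i, by omega⟩
        · exact ⟨gen_mem_semigroup i, 2, 0, zero_mem _, by omega⟩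
    rw [hΓ', Finset.card_pair (hpos i).ne]

variable (k : Type u) [Field k]

/-- Add to f - n the largest h ∈ H keeping the sum outside H; it exists because everything above f
is in H, and maximality makes the sum pseudo-Frobenius. -/
theorem exists_pseudoFrobenius (hpos : ∀ i, 0 < g i) {f : ℕ}
    (hlarge : ∀ n, f < n → n ∈ semigroup g) {n : ℤ} (hn : (f : ℤ) - n ∉ exponents (semigroup g)) :
    ∃ h ∈ exponents (semigroup g), (f : ℤ) - n + h ∈ pseudoFrobenius g ∧ h ≤ n := by
  let P : ℤ → Prop := fun h => h ∈ exponents (semigroup g) ∧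
    (f : ℤ) - n + h ∉ exponents (semigroup g)
  have hle : ∀ h, P h → h ≤ n := fun h hh => by
    by_contra hc
    exact hh.2 (mem_exponents_of_lt hlarge (by omega))
  obtain ⟨h, hh, hmax⟩ := Int.exists_greatest_of_bdd (P := P) ⟨n, hle⟩
    ⟨0, zero_mem_exponents, by rwa [add_zero]⟩
  refine ⟨h, hh.1, ⟨hh.2, fun i => ?_⟩, hle h hh⟩
  by_contra hc
  have h1 := hmax (h + g i) ⟨add_mem_exponents hh.1 (natCast_mem_exponents.2 (gen_mem_semigroup i)),
    by rwa [← add_assoc]⟩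
  have := hpos i
  omega

theorem mem_dualExponents_of_coeff_ne_zero {f : ℕ} {p : k⟦X⟧}
    (hp : p ∈ fractionalCanonicalIdeal k g f) (n : ℕ) (hn : PowerSeries.coeff n p ≠ 0) :
    (n : ℤ) ∈ dualExponents (semigroup g) f := by
  induction hp using Submodule.span_induction generalizing n with
  | mem p hp =>
    obtain ⟨c, hc, m, hm, rfl⟩ := hp
    rw [PowerSeries.coeff_X_pow] at hn
    have hnm : n = m := by
      by_contra h
      exact hn (if_neg h)
    subst hnm
    intro h
    rw [hm, sub_sub_cancel] at h
    exact hc.1 h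
  | zero => exact absurd (map_zero _) hn
  | add p q _ _ hp hq =>
    by_cases h : PowerSeries.coeff n p = 0
    · rw [map_add, h, zero_add] at hn
      exact hq n hn
    · exact hp n h
  | smul r p _ hp =>
    change PowerSeries.coeff n ((r : k⟦X⟧) * p) ≠ 0 at hn
    rw [PowerSeries.coeff_mul] at hn
    obtain ⟨ij, hij, hne⟩ := Finset.exists_ne_zero_of_sum_ne_zero hn
    have h1 : ij.1 ∈ semigroup g := by
      by_contra h
      exact left_ne_zero_of_mul hne (r.2 _ h)
    rw [← Finset.HasAntidiagonal.mem_antidiagonal.1 hij, Nat.cast_add]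
    exact add_mem_dualExponents _ (natCast_mem_exponents.2 h1) _ (hp _ (right_ne_zero_of_mul hne))

/-- If f - n ∉ H, some c = f - n + h is pseudo-Frobenius, so t^{n-h} is a generator of K = R + R
t^a, whence n - h or n - h - a lies in H. Conversely 0 and a are exponents of K, and these exponents
absorb H. -/
theorem mem_dualExponents_iff (hpos : ∀ i, 0 < g i) {f a : ℕ}
    (hlarge : ∀ n, f < n → n ∈ semigroup g)
    (hK : fractionalCanonicalIdeal k g f =
      Submodule.span (semigroupRing k (semigroup g))
        {(1 : PowerSeries k), (PowerSeries.X : PowerSeries k) ^ a}) (n : ℤ) :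
    (f : ℤ) - n ∉ exponents (semigroup g) ↔
      n ∈ exponents (semigroup g) ∨ n - a ∈ exponents (semigroup g) := by
  constructor
  · intro hn
    obtain ⟨h, hh, hPF, hle⟩ := exists_pseudoFrobenius hpos hlarge hn
    obtain ⟨m, hm⟩ := Int.eq_ofNat_of_zero_le (sub_nonneg.2 hle)
    have hX : (PowerSeries.X : k⟦X⟧) ^ m ∈ fractionalCanonicalIdeal k g f :=
      Submodule.subset_span ⟨_, hPF, m, by omega, rfl⟩
    rw [hK, Submodule.mem_span_pair] at hX
    obtain ⟨r, s, hrs⟩ := hX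
    change (r : k⟦X⟧) * 1 + (s : k⟦X⟧) * PowerSeries.X ^ a = _ at hrs
    have h1 := congrArg (PowerSeries.coeff m) hrs
    rw [map_add, mul_one, PowerSeries.coeff_mul_X_pow', PowerSeries.coeff_X_pow, if_pos rfl] at h1
    by_cases hmH : m ∈ semigroup g
    · left
      rw [show n = (m : ℤ) + h by omega]
      exact add_mem_exponents (natCast_mem_exponents.2 hmH) hh
    · right
      rw [r.2 m hmH, zero_add] at h1
      split_ifs at h1 with ham
      · have hma : m - a ∈ semigroup g := by
          by_contra hc
          rw [s.2 _ hc] at h1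
          exact zero_ne_one h1
        rw [show n - a = ((m - a : ℕ) : ℤ) + h by omega]
        exact add_mem_exponents (natCast_mem_exponents.2 hma) hh
      · exact absurd h1 zero_ne_one
  · have h1 : (0 : ℤ) ∈ dualExponents (semigroup g) f :=
      mem_dualExponents_of_coeff_ne_zero k (p := 1)
        (hK ▸ Submodule.subset_span (Set.mem_insert _ _)) 0 (by simp)
    have h2 : (a : ℤ) ∈ dualExponents (semigroup g) f :=
      mem_dualExponents_of_coeff_ne_zero k (p := PowerSeries.X ^ a)
        (hK ▸ Submodule.subset_span (Set.mem_insert_of_mem _ rfl)) a (by simp)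
    rintro (h | h)
    · have := add_mem_dualExponents _ h _ h1
      rwa [add_zero] at this
    · have := add_mem_dualExponents _ h _ h2
      rwa [sub_add_cancel] at this

end Combinatorics

/-! ### Powers of canonical ideals, units from reductions, and existence of a canonical ideal. -/

section Powers

variable {k : Type u} [Field k]

theorem exists_mem_supportedIn_sub_mem {U W : Set ℤ} {v : k⸨X⸩} (hv : v ∈ supportedIn k (U ∪ W)) :
    ∃ w ∈ supportedIn k U, v - w ∈ supportedIn k W := by
  classical
  let w : k⸨X⸩ := ⟨fun n => if n ∈ U then v.coeff n else 0,
    v.isPWO_support.mono fun n hn => by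
      rw [Function.mem_support] at hn
      rw [HahnSeries.mem_support]
      intro h
      rw [h, ite_self] at hn
      exact hn rfl⟩
  have hw : ∀ n, w.coeff n = if n ∈ U then v.coeff n else 0 := fun n => rfl
  refine ⟨w, fun n hn => by rw [hw, if_neg hn], fun n hn => ?_⟩
  rw [HahnSeries.coeff_sub, hw]
  split_ifs with h
  · exact sub_self _
  · rw [sub_zero]
    exact hv n fun h' => h'.elim h hn

theorem supportedIn_biUnion_le {P : AddSubgroup k⸨X⸩} {U : ℕ → Set ℤ} {J : ℕ}
    (h : ∀ j < J, ∀ v ∈ supportedIn k (U j), v ∈ P) :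
    ∀ v ∈ supportedIn k {n | ∃ j < J, n ∈ U j}, v ∈ P := by
  induction J with
  | zero =>
    intro v hv
    have : v = 0 := by
      ext n
      exact hv n fun ⟨j, hj, _⟩ => Nat.not_lt_zero j hj
    rw [this]
    exact P.zero_mem
  | succ J ih =>
    intro v hv
    have h1 : v ∈ supportedIn k (U J ∪ {n | ∃ j < J, n ∈ U j}) := by
      refine supportedIn_mono ?_ hv
      rintro n ⟨j, hj, hn⟩
      rcases (Nat.lt_succ_iff.1 hj).eq_or_lt with rfl | hlt
      · exact Or.inl hn
      · exact Or.inr ⟨j, hlt, hn⟩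
    obtain ⟨w, hw, hvw⟩ := exists_mem_supportedIn_sub_mem h1
    have := P.add_mem (h J (Nat.lt_succ_self J) w hw)
      (ih (fun j hj => h j (hj.trans (Nat.lt_succ_self J))) _ hvw)
    rwa [add_sub_cancel] at this

theorem pow_mem_supportedIn_exponents {H : AddSubmonoid ℕ} {v : k⸨X⸩}
    (hv : v ∈ supportedIn k (exponents H)) (n : ℕ) : v ^ n ∈ supportedIn k (exponents H) := by
  induction n with
  | zero =>
    rw [pow_zero]
    exact one_mem_supportedIn zero_mem_exponents
  | succ n ih =>
    rw [pow_succ]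
    exact mul_mem_supportedIn (fun s hs t ht => add_mem_exponents hs ht) ih hv

variable {H : AddSubmonoid ℕ} {a : ℕ}

theorem mem_sup_multiples_iff {n : ℕ} :
    n ∈ H ⊔ AddSubmonoid.multiples a ↔ ∃ j, ∃ h ∈ H, n = h + j * a := by
  rw [AddSubmonoid.mem_sup]
  constructor
  · rintro ⟨h, hh, _, ⟨j, rfl⟩, rfl⟩
    exact ⟨j, h, hh, by simp⟩
  · rintro ⟨j, h, hh, rfl⟩
    exact ⟨h, hh, j * a, ⟨j, by simp⟩, rfl⟩

theorem subset_exponents_sup_multiples {T : Set ℤ}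
    (hT : ∀ n, n ∈ T ↔ n ∈ exponents H ∨ n - a ∈ exponents H) :
    T ⊆ exponents (H ⊔ AddSubmonoid.multiples a) := by
  intro m hm
  rcases (hT m).1 hm with ⟨h, hh, rfl⟩ | ⟨h, hh, hm⟩
  · exact natCast_mem_exponents.2 ((le_sup_left : H ≤ H ⊔ AddSubmonoid.multiples a) hh)
  · exact ⟨h + 1 * a, mem_sup_multiples_iff.2 ⟨1, h, hh, rfl⟩, by push_cast; omega⟩

variable {T : Set ℤ} {I : Ideal (semigroupRing k H)} {β : k⸨X⸩}

theorem exists_mul_eq_of_mem_pow {H' : AddSubmonoid ℕ} (hH : H ≤ H')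
    (hI : ∀ r ∈ I, ∃ v ∈ supportedIn k (exponents H'),
      algebraMap (semigroupRing k H) k⸨X⸩ r = β * v) (m : ℕ) :
    ∀ r ∈ I ^ m, ∃ v ∈ supportedIn k (exponents H'),
      algebraMap (semigroupRing k H) k⸨X⸩ r = β ^ m * v := by
  induction m with
  | zero =>
    intro r _
    refine ⟨_, supportedIn_mono ?_ (algebraMap_mem_supportedIn r), by rw [pow_zero, one_mul]⟩
    rintro n ⟨m, hm, rfl⟩
    exact ⟨m, hH hm, rfl⟩
  | succ m ih =>
    intro r hr
    rw [pow_succ] at hr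
    induction hr using Submodule.mul_induction_on' with
    | mem_mul_mem r hr s hs =>
      obtain ⟨v, hv, hv'⟩ := ih r hr
      obtain ⟨w, hw, hw'⟩ := hI s hs
      refine ⟨v * w, mul_mem_supportedIn (fun s hs t ht => add_mem_exponents hs ht) hv hw, ?_⟩
      rw [map_mul, hv', hw', pow_succ]
      ring
    | add r _ s _ hr hs =>
      obtain ⟨v, hv, hv'⟩ := hr
      obtain ⟨w, hw, hw'⟩ := hs
      exact ⟨v + w, Submodule.add_mem _ hv hw, by rw [map_add, hv', hw', mul_add]⟩

/-- Products of β and βt^a put β^m t^{ja} in I^m for j ≤ m. Exponents h + ja with j ≤ f + 1 are thus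
covered when f + 1 ≤ m; for larger j the exponent exceeds f and lies in H already. -/
theorem exists_mem_pow_of_supportedIn {f : ℕ} (ha : 0 < a) (hlarge : ∀ n, f < n → n ∈ H)
    {x₀ x₁ : semigroupRing k H} (hx₀ : x₀ ∈ I) (hx₁ : x₁ ∈ I)
    (hx₀β : algebraMap (semigroupRing k H) k⸨X⸩ x₀ = β)
    (hx₁β : algebraMap (semigroupRing k H) k⸨X⸩ x₁ = β * HahnSeries.single (a : ℤ) 1)
    {m : ℕ} (hm : f + 1 ≤ m) :
    ∀ v ∈ supportedIn k (exponents (H ⊔ AddSubmonoid.multiples a)),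
      ∃ r ∈ I ^ m, algebraMap (semigroupRing k H) k⸨X⸩ r = β ^ m * v := by
  let P : AddSubgroup k⸨X⸩ :=
    { carrier := {v | ∃ r ∈ I ^ m, algebraMap (semigroupRing k H) k⸨X⸩ r = β ^ m * v}
      add_mem' := by
        rintro v w ⟨r, hr, hv⟩ ⟨s, hs, hw⟩
        exact ⟨r + s, Ideal.add_mem _ hr hs, by rw [map_add, hv, hw, mul_add]⟩
      zero_mem' := ⟨0, Ideal.zero_mem _, by rw [map_zero, mul_zero]⟩
      neg_mem' := by
        rintro v ⟨r, hr, hv⟩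
        exact ⟨-r, neg_mem hr, by rw [map_neg, hv, mul_neg]⟩ }
  intro v hv
  refine supportedIn_biUnion_le (P := P) (U := fun j => {n | n - j * a ∈ exponents H})
    (J := f + 2) (fun j hj w hw => ?_) v (supportedIn_mono ?_ hv)
  · have h1 : HahnSeries.single (-(j * a : ℤ)) 1 * w ∈ supportedIn k (exponents H) :=
      mul_mem_supportedIn (fun s hs t (ht : t - j * a ∈ exponents H) => by
        rw [Set.mem_singleton_iff.1 hs, neg_add_eq_sub]
        exact ht) (single_mem_supportedIn (Set.mem_singleton _) 1) hw
    obtain ⟨r, hr⟩ := exists_algebraMap_eq h1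
    have h2 : x₀ ^ (m - j) * x₁ ^ j ∈ I ^ m := by
      have := Ideal.mul_mem_mul (Ideal.pow_mem_pow hx₀ (m - j)) (Ideal.pow_mem_pow hx₁ j)
      rwa [← pow_add, Nat.sub_add_cancel (by omega)] at this
    refine ⟨r * (x₀ ^ (m - j) * x₁ ^ j), Ideal.mul_mem_left _ _ h2, ?_⟩
    rw [map_mul, map_mul, map_pow, map_pow, hr, hx₀β, hx₁β, mul_pow, HahnSeries.single_pow, one_pow,
      ← mul_assoc (β ^ (m - j)), ← pow_add, Nat.sub_add_cancel (by omega : j ≤ m), nsmul_eq_mul,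
      mul_comm, mul_assoc, ← mul_assoc (HahnSeries.single _ _), HahnSeries.single_mul_single,
      add_neg_cancel, mul_one]
    congr 1
    exact one_mul w
  · rintro n ⟨n, hn, rfl⟩
    obtain ⟨j, h, hh, rfl⟩ := mem_sup_multiples_iff.1 hn
    by_cases hj : j < f + 2
    · refine ⟨j, hj, h, hh, ?_⟩
      push_cast
      ring
    · refine ⟨0, by omega, h + j * a, hlarge _ ?_, by push_cast; ring⟩
      have : j * 1 ≤ j * a := Nat.mul_le_mul_left j ha
      omega

/-- The rank of the Sally module of a canonical ideal of `k[[H]]`, when the canonical fractional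
ideal is `R + R t^a`. -/
theorem sallyRank_canonicalIdeal {f : ℕ} (ha : 0 < a) (hlarge : ∀ n, f < n → n ∈ H)
    (hT : ∀ n, n ∈ T ↔ n ∈ exponents H ∨ n - a ∈ exponents H) (hβ : β ≠ 0)
    (hI : ∀ x, (∃ r ∈ I, algebraMap (semigroupRing k H) k⸨X⸩ r = β * x) ↔ x ∈ supportedIn k T)
    {α : semigroupRing k H} (hα : α ∈ nonZeroDivisors (semigroupRing k H))
    (hred : IsReductionOf (Ideal.span {α}) I) (Δ : Finset ℕ)
    (hΔ : ∀ n : ℕ, n ∈ Δ ↔ n ∈ H ⊔ AddSubmonoid.multiples a ∧ (n : ℤ) ∉ T) :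
    sallyRank I α hα = Δ.card := by
  obtain ⟨hle, n, hn⟩ := hred
  have hαI : α ∈ I := (Ideal.span_singleton_le_iff_mem I).1 hle
  obtain ⟨x₀, hx₀, hx₀β⟩ := (hI 1).2 (one_mem_supportedIn ((hT 0).2 (Or.inl zero_mem_exponents)))
  obtain ⟨x₁, hx₁, hx₁β⟩ := (hI (HahnSeries.single (a : ℤ) 1)).2
    (single_mem_supportedIn ((hT a).2 (Or.inr (by rw [sub_self]; exact zero_mem_exponents))) 1)
  rw [mul_one] at hx₀β
  have hHH' : H ≤ H ⊔ AddSubmonoid.multiples a := le_sup_left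
  have hTH' : T ⊆ exponents (H ⊔ AddSubmonoid.multiples a) := subset_exponents_sup_multiples hT
  have hI' : ∀ r ∈ I, ∃ v ∈ supportedIn k (exponents (H ⊔ AddSubmonoid.multiples a)),
      algebraMap (semigroupRing k H) k⸨X⸩ r = β * v := fun r hr =>
    ⟨β⁻¹ * algebraMap (semigroupRing k H) k⸨X⸩ r, supportedIn_mono hTH' ((hI _).1 ⟨r, hr, by
      rw [mul_inv_cancel_left₀ hβ]⟩), by rw [mul_inv_cancel_left₀ hβ]⟩
  have hpow := exists_mul_eq_of_mem_pow hHH' hI'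
  have hpow' : ∀ m, f + 1 ≤ m → _ := fun m hm =>
    exists_mem_pow_of_supportedIn ha hlarge hx₀ hx₁ hx₀β hx₁β hm
  obtain ⟨u, hu, hαu⟩ := hI' α hαI
  -- With M = n + f + 2, both β^M ∈ I^M and I^M = α I^{M-1} hold. Writing β^M = α β^{M-1} v with v ∈
  -- S gives uv = 1, so α^m β S = β^{m+1} S for all m.
  have huinv : u⁻¹ ∈ supportedIn k (exponents (H ⊔ AddSubmonoid.multiples a)) := by
    obtain ⟨r, hr, hrβ⟩ := hpow' (n + (f + 1) + 1) (by omega) 1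
      (one_mem_supportedIn zero_mem_exponents)
    have h1 : I ^ (n + (f + 1) + 1) = Ideal.span {α} * I ^ (n + (f + 1)) := by
      rw [Nat.add_right_comm, pow_add, hn, mul_assoc, ← pow_add]
    rw [h1] at hr
    obtain ⟨s, hs, rfl⟩ := Ideal.mem_span_singleton_mul.1 hr
    obtain ⟨v, hv, hsv⟩ := hpow _ s hs
    have h2 : u * v = 1 := by
      rw [map_mul, hαu, hsv] at hrβ
      refine mul_left_cancel₀ (pow_ne_zero (n + (f + 1) + 1) hβ) ?_
      rw [← hrβ]
      ring
    rw [← eq_inv_of_mul_eq_one_right h2]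
    exact hv
  refine sallyRank_semigroupRing hHH' (fun h hh t ht => (hT _).2 ?_) hα hαI hβ hI
    (fun m r hr => ?_) ⟨f + 1, fun v hv => ?_⟩ Δ hΔ
  · rcases (hT t).1 ht with ht | ht
    · exact Or.inl (add_mem_exponents hh ht)
    · right
      rw [add_sub_assoc]
      exact add_mem_exponents hh ht
  · obtain ⟨v, hv, hrv⟩ := hpow _ r hr
    convert mul_mem_supportedIn (fun s hs t ht => add_mem_exponents hs ht)
      (pow_mem_supportedIn_exponents huinv m) hv using 1
    rw [hrv, hαu, mul_pow, inv_pow, pow_succ]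
    field_simp
  · obtain ⟨r, hr, hrv⟩ := hpow' (f + 1 + 1) (by omega) (u ^ (f + 1) * v)
      (mul_mem_supportedIn (fun s hs t ht => add_mem_exponents hs ht)
        (pow_mem_supportedIn_exponents hu _) hv)
    refine ⟨r, hr, ?_⟩
    rw [hrv, hαu, mul_pow]
    ring

/-- The ring `k[[H]]` has a canonical ideal `t^{f+1} K` with the reduction `(t^{f+1})`. -/
theorem exists_canonicalIdeal {f : ℕ} (ha : 0 < a) (hlarge : ∀ n, f < n → n ∈ H)
    (hdual : ∀ n, n ∈ dualExponents H f ↔ n ∈ exponents H ∨ n - a ∈ exponents H) :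
    ∃ (I : Ideal (semigroupRing k H)) (α : semigroupRing k H),
      α ∈ nonZeroDivisors (semigroupRing k H) ∧ IsCanonicalIdeal (semigroupRing k H) I ∧
      IsReductionOf (Ideal.span {α}) I ∧
      ∀ x, (∃ r ∈ I, algebraMap (semigroupRing k H) k⸨X⸩ r =
        algebraMap (semigroupRing k H) k⸨X⸩ α * x) ↔
        x ∈ supportedIn k (dualExponents H f) := by
  have hlargeZ := fun n => mem_exponents_of_lt (n := n) hlarge
  -- α = t^{f+1}: exponents of K are nonnegative, so αK has all exponents above f and lies in R.
  obtain ⟨α, hα⟩ := exists_algebraMap_eq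
    (single_mem_supportedIn (hlargeZ ((f : ℤ) + 1) (by omega)) (1 : k))
  have hα0 : algebraMap (semigroupRing k H) k⸨X⸩ α ≠ 0 := by
    rw [hα]
    exact HahnSeries.single_ne_zero one_ne_zero
  let I : Ideal (semigroupRing k H) := supportIdeal (algebraMap (semigroupRing k H) k⸨X⸩ α)
    (dualExponents H f) add_mem_dualExponents
  have hnonneg : ∀ n ∈ dualExponents H f, 0 ≤ n := fun n hn => by
    by_contra hc
    exact hn (hlargeZ _ (by omega))
  have hI : ∀ x, (∃ r ∈ I, algebraMap (semigroupRing k H) k⸨X⸩ r =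
        algebraMap (semigroupRing k H) k⸨X⸩ α * x) ↔
        x ∈ supportedIn k (dualExponents H f) := by
    intro x
    constructor
    · rintro ⟨r, hr, hrx⟩
      have := mem_supportIdeal.1 hr
      rwa [hrx, inv_mul_cancel_left₀ hα0] at this
    · intro hx
      have h1 : algebraMap (semigroupRing k H) k⸨X⸩ α * x ∈ supportedIn k (exponents H) := by
        rw [hα]
        refine mul_mem_supportedIn (fun s hs t ht => ?_)
          (single_mem_supportedIn (Set.mem_singleton _) 1) hx
        have := hnonneg t ht
        rw [Set.mem_singleton_iff.1 hs]
        exact hlargeZ _ (by omega)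
      obtain ⟨r, hr⟩ := exists_algebraMap_eq h1
      refine ⟨r, mem_supportIdeal.2 ?_, hr⟩
      rwa [hr, inv_mul_cancel_left₀ hα0]
  obtain ⟨x₀, hx₀, hx₀β⟩ := (hI 1).2
    (one_mem_supportedIn ((hdual 0).2 (Or.inl zero_mem_exponents)))
  obtain ⟨x₁, hx₁, hx₁β⟩ := (hI (HahnSeries.single (a : ℤ) 1)).2
    (single_mem_supportedIn ((hdual a).2 (Or.inr (by rw [sub_self]; exact zero_mem_exponents))) 1)
  rw [mul_one] at hx₀β
  obtain rfl := algebraMap_semigroupRing_injective hx₀β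
  have hHH' : H ≤ H ⊔ AddSubmonoid.multiples a := le_sup_left
  refine ⟨I, x₀, mem_nonZeroDivisors_of_ne_zero fun h => hα0 (by rw [h, map_zero]), ⟨?_, ?_⟩,
    ⟨(Ideal.span_singleton_le_iff_mem I).2 hx₀, f + 1, ?_⟩, hI⟩
  · rw [Ideal.ne_top_iff_one]
    intro h
    have h1 := mem_supportIdeal.1 h
    rw [map_one, mul_one, hα, HahnSeries.inv_single, inv_one] at h1
    have h2 := h1 (-((f : ℤ) + 1)) (fun hc => by have := hnonneg _ hc; omega)
    rw [HahnSeries.coeff_single_same] at h2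
    exact one_ne_zero h2
  · refine isCanonicalModule_of_forall_mem_iff hlarge I ?_ hα0 hI
    have hfg : I = Ideal.span {x₀, x₁} := by
      refine le_antisymm (fun r hr => ?_) (Ideal.span_le.2 ?_)
      · have h1 : (algebraMap (semigroupRing k H) k⸨X⸩ x₀)⁻¹ *
            algebraMap (semigroupRing k H) k⸨X⸩ r ∈
              supportedIn k (exponents H ∪ {n | n - a ∈ exponents H}) :=
          supportedIn_mono (fun n hn => (hdual n).1 hn) (mem_supportIdeal.1 hr)
        obtain ⟨w, hw, hw'⟩ := exists_mem_supportedIn_sub_mem h1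
        obtain ⟨s, rfl⟩ := exists_algebraMap_eq hw
        have h2 : HahnSeries.single (-(a : ℤ)) 1 *
            ((algebraMap (semigroupRing k H) k⸨X⸩ x₀)⁻¹ *
            algebraMap (semigroupRing k H) k⸨X⸩ r - algebraMap (semigroupRing k H) k⸨X⸩ s) ∈
            supportedIn k (exponents H) :=
          mul_mem_supportedIn (fun i hi t (ht : t - a ∈ exponents H) => by
            rw [Set.mem_singleton_iff.1 hi, neg_add_eq_sub]
            exact ht) (single_mem_supportedIn (Set.mem_singleton _) 1) hw'
        obtain ⟨s', hs'⟩ := exists_algebraMap_eq h2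
        rw [Ideal.mem_span_pair]
        refine ⟨s, s', algebraMap_semigroupRing_injective ?_⟩
        have h3 : (HahnSeries.single (-(a : ℤ)) 1 : k⸨X⸩) * HahnSeries.single (a : ℤ) 1 = 1 := by
          rw [HahnSeries.single_mul_single, neg_add_cancel, mul_one]
          rfl
        rw [map_add, map_mul, map_mul, hx₁β, hs']
        calc _ = algebraMap (semigroupRing k H) k⸨X⸩ s * algebraMap (semigroupRing k H) k⸨X⸩ x₀ +
              (HahnSeries.single (-(a : ℤ)) 1 * HahnSeries.single (a : ℤ) 1) *
              (algebraMap (semigroupRing k H) k⸨X⸩ x₀ *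
                ((algebraMap (semigroupRing k H) k⸨X⸩ x₀)⁻¹ *
                  algebraMap (semigroupRing k H) k⸨X⸩ r) -
                algebraMap (semigroupRing k H) k⸨X⸩ x₀ *
                  algebraMap (semigroupRing k H) k⸨X⸩ s) := by ring
          _ = _ := by rw [h3, mul_inv_cancel_left₀ hα0]; ring
      · rintro x (rfl | rfl)
        · exact hx₀
        · exact hx₁
    rw [Module.Finite.iff_fg, hfg]
    exact Submodule.fg_span (Set.toFinite _)
  · refine le_antisymm (fun r hr => ?_) ?_
    -- I^{f+2} ⊆ α^{f+2} S = α (α^{f+1} S), and α^{f+1} S is contained in I^{f+1}.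
    · have hTH' : dualExponents H f ⊆ exponents (H ⊔ AddSubmonoid.multiples a) :=
        subset_exponents_sup_multiples hdual
      obtain ⟨v, hv, hrv⟩ := exists_mul_eq_of_mem_pow
        (β := algebraMap (semigroupRing k H) k⸨X⸩ x₀) hHH' (fun r hr =>
          ⟨(algebraMap (semigroupRing k H) k⸨X⸩ x₀)⁻¹ *
            algebraMap (semigroupRing k H) k⸨X⸩ r, supportedIn_mono hTH'
            (mem_supportIdeal.1 hr), by rw [mul_inv_cancel_left₀ hα0]⟩) _ r hr
      obtain ⟨s, hs, hsv⟩ := exists_mem_pow_of_supportedIn ha hlarge hx₀ hx₁ rfl hx₁β le_rfl v hv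
      refine Ideal.mem_span_singleton_mul.2 ⟨s, hs, algebraMap_semigroupRing_injective ?_⟩
      rw [map_mul, hsv, hrv]
      ring
    · rw [pow_succ' I (f + 1)]
      exact Ideal.mul_mono ((Ideal.span_singleton_le_iff_mem I).2 hx₀) le_rfl

end Powers

/-! ### Conclusion: the rank condition translated into the semigroup. -/

/-- When the canonical fractional ideal is `R + R t^a`, the ring `R = k[[H]]` is 2-AGL if and only
if `3a ∈ H` and `f = 2a + g i` for some `i`. -/
theorem isTwoAGL_semigroupRing_iff {k : Type u} [Field k] {ℓ : ℕ} (g : Fin ℓ → ℕ)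
    (hpos : ∀ i, 0 < g i) (hmin : ∀ j, g j ∉ AddSubmonoid.closure (g '' {i | i ≠ j}))
    (f : ℕ) (hf : FrobeniusNumber f (Set.range g)) (a : ℕ) (ha : 0 < a)
    (hK : fractionalCanonicalIdeal k g f = Submodule.span (semigroupRing k (semigroup g))
        {(1 : PowerSeries k), (PowerSeries.X : PowerSeries k) ^ a}) :
    IsTwoAGL (semigroupRing k (semigroup g)) ↔ 3 * a ∈ semigroup g ∧ ∃ i, f = 2 * a + g i := by
  classical
  obtain ⟨hfH, hlarge⟩ : f ∉ semigroup g ∧ ∀ n, f < n → n ∈ semigroup g :=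
    frobeniusNumber_iff.1 hf
  have hdual := mem_dualExponents_iff k hpos hlarge hK
  let Δ : Finset ℕ := (Finset.range (f + 1)).filter fun n =>
    n ∈ semigroup g ⊔ AddSubmonoid.multiples a ∧ (n : ℤ) ∉ dualExponents (semigroup g) f
  have hle : ∀ n : ℕ, (n : ℤ) ∉ dualExponents (semigroup g) f → n ≤ f := fun n hn => by
    have := nonneg_of_mem_exponents (not_not.1 hn)
    omega
  have hΔ : ∀ n : ℕ, n ∈ Δ ↔ n ∈ semigroup g ⊔ AddSubmonoid.multiples a ∧
      (n : ℤ) ∉ dualExponents (semigroup g) f := fun n => by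
    rw [Finset.mem_filter, Finset.mem_range, and_iff_right_of_imp]
    exact fun h => Nat.lt_succ_of_le (hle n h.2)
  have hΔf : ∀ n ∈ Δ, n ≤ f := fun n hn => hle n ((hΔ n).1 hn).2
  -- The reflection n ↦ f - n turns n ∈ H' outside T into h ∈ H with f - h ∈ H + ℕa. Elements of Δ
  -- are at most f, so the truncated subtraction loses nothing.
  have hcard : (Δ.image (f - ·)).card = Δ.card := Finset.card_image_of_injOn fun m hm n hn h => by
    have h1 := hΔf m hm
    have h2 := hΔf n hn
    change f - m = f - n at h
    omega
  rw [← card_eq_two_iff hpos hmin ha hfH hdual (Δ.image (f - ·)) (fun h => ?_), hcard]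
  · constructor
    · rintro ⟨I, α, hα, hI, hred, hrank⟩
      obtain ⟨β, hβ, hIβ⟩ := exists_forall_mem_canonicalFractional_iff hlarge I hI.2.type_one
      rw [sallyRank_canonicalIdeal ha hlarge hdual hβ hIβ hα hred Δ hΔ] at hrank
      exact_mod_cast hrank
    · intro h2
      obtain ⟨I, α, hα, hI, hred, hIα⟩ := exists_canonicalIdeal (k := k) ha hlarge hdual
      refine ⟨I, α, hα, hI, hred, ?_⟩
      rw [sallyRank_canonicalIdeal ha hlarge hdual (by
        rw [Ne, FaithfulSMul.algebraMap_eq_zero_iff]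
        exact nonZeroDivisors.ne_zero hα) hIα hα hred Δ hΔ, h2]
      rfl
  · rw [Finset.mem_image]
    constructor
    · rintro ⟨n, hn, rfl⟩
      have hnf := hΔf n hn
      obtain ⟨hn1, hn2⟩ := (hΔ n).1 hn
      obtain ⟨j, h', hh', hnj⟩ := mem_sup_multiples_iff.1 hn1
      refine ⟨?_, j, h', hh', by omega⟩
      have h3 : (f : ℤ) - n ∈ exponents (semigroup g) := not_not.1 hn2
      rwa [← Nat.cast_sub hnf, natCast_mem_exponents] at h3
    · rintro ⟨hh, j, h', hh', hfj⟩
      refine ⟨f - h, (hΔ _).2 ⟨mem_sup_multiples_iff.2 ⟨j, h', hh', by omega⟩, fun hc => hc ?_⟩,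
        by omega⟩
      rw [Nat.cast_sub (by omega), sub_sub_cancel, natCast_mem_exponents]
      exact hh

end TwoAGL

end

theorem theorem7p2 {k : Type u} [Field k] {ℓ : ℕ} (hℓ : 3 ≤ ℓ) (g : Fin ℓ → ℕ)
    (hpos : ∀ i, 0 < g i) (hgcd : Finset.univ.gcd g = 1)
    (hmin : ∀ j, g j ∉ AddSubmonoid.closure (g '' {i | i ≠ j}))
    (f : ℕ) (hf : FrobeniusNumber f (Set.range g))
    (htype : TwoAGL.cmType (TwoAGL.semigroupRing k (TwoAGL.semigroup g)) = 2)
    (a : ℕ) (ha : 0 < a)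
    (hK : TwoAGL.fractionalCanonicalIdeal k g f =
      Submodule.span (TwoAGL.semigroupRing k (TwoAGL.semigroup g))
        {(1 : PowerSeries k), (PowerSeries.X : PowerSeries k) ^ a}) :
    TwoAGL.IsTwoAGL (TwoAGL.semigroupRing k (TwoAGL.semigroup g)) ↔
      3 * a ∈ TwoAGL.semigroup g ∧ ∃ i, f = 2 * a + g i :=
  TwoAGL.isTwoAGL_semigroupRing_iff g hpos hmin f hf a ha hK
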